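/- **Setting.** An instance consists of $n\ge 1$ bidders, $m$ categories (items), an integer $K\ge 0$, rational prior probabilities $p_j\ge 0$ with $\sum_{j=1}^m p_j=1$, and rational valuations $v_{ij}$; put $V_{ij}=v_{ij}p_j$. A signaling scheme is a map $\varphi$ from categories to signals, the support of a signal $S$ is $\varphi^{-1}(S)$, and the welfare of $\varphi$ is $$\sum_{S}\Pr[S]\,\max_i \mathbf E[v_i\mid S],\qquad \Pr[S]=\sum_{j\in\varphi^{-1}(S)}p_j,\quad \mathbf E[v_i\mid S]=\frac{\sum_{j\in\varphi^{-1}(S)}v_{ij}p_j}{\Pr[S]},$$ the sum being over the signals used (a signal of probability $0$ contributes $0$). For a constant $c$, a scheme is *admissible* if it uses at most $c$ signals and each signal used has support of size at least $K$; it is *optimal* if it has maximum welfare among the admissible schemes. **Algorithm.** Enumerate the nonempty sets $W$ of at most $c$ bidders (the winners). For each $W$: 1. Let $g$ assign each item $j$ to a bidder $g(j)\in W$ with $V_{g(j)j}=\max_{i\in W}V_{ij}$, and let $k_i=|g^{-1}(i)|$. 2. Find a minimum-cost integral feasible flow $f$ from $st$ to $end$, if there is a feasible one, in the network with vertices $st$,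 $end$, $w_i$, $w_i'$, $item_j$ and the following arcs, labelled (lower bound, upper bound, unit cost), for $i\in W$: $st\to w_i$ with $(k_i,k_i,0)$; $w_i\to w_i'$ with $(0,\infty,0)$; $w_i'\to end$ with $(K,\infty,0)$; $w_i'\to item_j$ with $(0,1,V_{ij})$ for each $j$ with $g(j)=i$; and $item_j\to w_i$ with $(0,1,-V_{ij})$ for each $j$ with $g(j)\ne i$. 3. Reassign every item $j$ for which $f$ sends a unit along an arc $item_j\to w_i$ to that bidder $i$; the other items stay with $g(j)$. The value for $W$ is $\sum_j V_{g(j)j}$ minus the cost of $f$. A result of the algorithm is the reassignment obtained for a set $W$, among those with a feasible flow, of largest value (ties at any point are broken arbitrarily). Its scheme gives each category, as its signal, the bidder it is assigned to. **Claim.** For every constant $c\ge 0$: 1. On every instance at most $n^c$ sets $W$ are enumerated, the algorithm has a result if and only if an admissible scheme exists, and the scheme of every result is optimal. 2. There are a program for a random access machine with logarithmic cost (every operation on natural or rational numbers costs one plus the number of bits of its operands) and a polynomial $q$, both depending only on $c$, such that on every instance the program halts at cost at most $q(N)$, where $N$ is $n+m$ plus the number of bits of $K$, of all $p_j$ and of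 all $v_{ij}$. If an admissible scheme exists, it reports this and outputs an optimal scheme which is the scheme of a result of the algorithm; otherwise it reports that there is none. -/

import Mathlib

open Finset

namespace KAnon

/-! ## Signaling problem -/

/-- One impression, of one of `m` categories, is auctioned to `n` bidders: category `j` has prior
probability `p j`, and bidder `i` values it `v i j`. Every signal has to have support at least
`K`. The numbers are rational, so that they can be the input of a machine. -/
structure Problem where
  n : ℕ
  m : ℕ
  K : ℕ
  p : Fin m → ℚ
  v : Fin n → Fin m → ℚ
  n_pos : 0 < n
  p_nonneg : ∀ j, 0 ≤ p j
  p_sum : ∑ j, p j = 1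

namespace Problem

variable (I : Problem)

/-- `V i j = v i j * p j`. -/
def V (i : Fin I.n) (j : Fin I.m) : ℚ := I.v i j * I.p j

/-- The categories for which the signal `S` is broadcast, under the deterministic scheme `φ`
which broadcasts `φ j` when the category is `j` (signals are named by natural numbers). -/
def support (φ : Fin I.m → ℕ) (S : ℕ) : Finset (Fin I.m) := univ.filter fun j => φ j = S

/-- The signals that the scheme uses. -/
def signals (φ : Fin I.m → ℕ) : Finset ℕ := univ.image φ

/-- The probability that `S` is broadcast. -/
def prob (φ : Fin I.m → ℕ) (S : ℕ) : ℚ := ∑ j ∈ I.support φ S, I.p j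

/-- The posterior expectation `E[v_i | S]` of the value of bidder `i`. -/
def condValue (φ : Fin I.m → ℕ) (S : ℕ) (i : Fin I.n) : ℚ :=
  ∑ j ∈ I.support φ S, I.v i j * (I.p j / I.prob φ S)

theorem bidders_nonempty : (univ : Finset (Fin I.n)).Nonempty := ⟨⟨0, I.n_pos⟩, mem_univ _⟩

/-- The highest posterior expectation among the bidders. -/
def topValue (φ : Fin I.m → ℕ) (S : ℕ) : ℚ :=
  univ.sup' I.bidders_nonempty (I.condValue φ S)

/-- Expected social welfare `∑_S Pr[S] max_i E[v_i | S]`. -/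
def welfare (φ : Fin I.m → ℕ) : ℚ := ∑ S ∈ I.signals φ, I.prob φ S * I.topValue φ S

/-- The scheme uses at most `c` signals and each of them has support at least `K`. -/
def IsAdmissible (c : ℕ) (φ : Fin I.m → ℕ) : Prop :=
  (I.signals φ).card ≤ c ∧ ∀ S ∈ I.signals φ, I.K ≤ (I.support φ S).card

/-- The scheme has maximum welfare among the `K`-anonymous schemes with at most `c` signals. -/
def IsOptimal (c : ℕ) (φ : Fin I.m → ℕ) : Prop :=
  I.IsAdmissible c φ ∧ ∀ ψ, I.IsAdmissible c ψ → I.welfare ψ ≤ I.welfare φ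

end Problem

/-! ## Minimum-cost feasible flow with lower bounds -/

/-- The data `(l, u, c)` of an arc. -/
structure Arc where
  lower : ℕ
  upper : ℕ∞
  cost : ℚ

/-- A network on the vertex set `α`; `arc x y = none` says that there is no arc from `x` to `y`. -/
structure Network (α : Type) where
  source : α
  sink : α
  arc : α → α → Option Arc

namespace Network

variable {α : Type} [Fintype α] (G : Network α)

/-- `f` is an integral feasible flow: it respects the bounds, vanishes off the arcs, and is
conserved at every vertex other than the source and the sink. -/
def IsFeasible (f : α → α → ℕ) : Prop :=
  (∀ x y, G.arc x y = none → f x y = 0) ∧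
  (∀ x y e, G.arc x y = some e → e.lower ≤ f x y ∧ (f x y : ℕ∞) ≤ e.upper) ∧
  ∀ x, x ≠ G.source → x ≠ G.sink → ∑ y, f y x = ∑ y, f x y

/-- Cost of one unit of flow from `x` to `y`. -/
def unitCost (x y : α) : ℚ := ((G.arc x y).map Arc.cost).getD 0

def cost (f : α → α → ℕ) : ℚ := ∑ x, ∑ y, (f x y : ℚ) * G.unitCost x y

def IsMinCost (f : α → α → ℕ) : Prop :=
  G.IsFeasible f ∧ ∀ f', G.IsFeasible f' → G.cost f ≤ G.cost f'

end Network

/-! ## The algorithm: enumerate winners, best-bidder assignment, repair by a flow -/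

/-- Vertices of the repair network: two copies of every bidder and one vertex per category. -/
inductive Node (n m : ℕ) where
  | st : Node n m
  | fin : Node n m
  | bidder : Fin n → Node n m
  | bidder' : Fin n → Node n m
  | item : Fin m → Node n m
  deriving DecidableEq, Fintype

namespace Problem

variable (I : Problem)

/-- The enumerated sets of winners. -/
def winnerSets (c : ℕ) : Finset (Finset (Fin I.n)) :=
  univ.filter fun W => W.Nonempty ∧ W.card ≤ c

/-- `g` gives each item to a winner (a bidder in `W`) who favors it most. -/
def IsBestAssignment (W : Finset (Fin I.n)) (g : Fin I.m → Fin I.n) : Prop :=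
  ∀ j, g j ∈ W ∧ ∀ i ∈ W, I.V i j ≤ I.V (g j) j

/-- The arcs of the repair network for the winners `W` and the initial assignment `g`. -/
def repairArc (W : Finset (Fin I.n)) (g : Fin I.m → Fin I.n) :
    Node I.n I.m → Node I.n I.m → Option Arc
  -- bidder `i` starts with the items that `g` gives to it
  | .st, .bidder i =>
      if i ∈ W then
        some ⟨(univ.filter fun j => g j = i).card, (univ.filter fun j => g j = i).card, 0⟩
      else none
  | .bidder i, .bidder' i' => if i ∈ W ∧ i' = i then some ⟨0, ⊤, 0⟩ else none
  -- bidder `i` ends with at least `K` items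
  | .bidder' i, .fin => if i ∈ W then some ⟨I.K, ⊤, 0⟩ else none
  -- bidder `i` may give away an item `j` of its own, which lowers the welfare by `V i j`
  | .bidder' i, .item j => if i ∈ W ∧ g j = i then some ⟨0, 1, I.V i j⟩ else none
  -- bidder `i` may gain an item `j` of another one, which raises the welfare by `V i j`
  | .item j, .bidder i => if i ∈ W ∧ g j ≠ i then some ⟨0, 1, -I.V i j⟩ else none
  | _, _ => none

def repairNetwork (W : Finset (Fin I.n)) (g : Fin I.m → Fin I.n) :
    Network (Node I.n I.m) where
  source := .st
  sink := .fin
  arc := I.repairArc W g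

/-- The assignment after the repair: item `j` goes to the bidder that its unit of flow, if any,
is sent to, and otherwise stays where it was. -/
noncomputable def reassign (g : Fin I.m → Fin I.n) (f : Node I.n I.m → Node I.n I.m → ℕ)
    (j : Fin I.m) : Fin I.n :=
  if h : ∃ i, 0 < f (.item j) (.bidder i) then h.choose else g j

/-- For the winners `W`, the last two steps of the algorithm can produce `g` and `f`. -/
def IsRepair (W : Finset (Fin I.n)) (g : Fin I.m → Fin I.n)
    (f : Node I.n I.m → Node I.n I.m → ℕ) : Prop :=
  I.IsBestAssignment W g ∧ (I.repairNetwork W g).IsMinCost f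

/-- Welfare of the best-bidder assignment minus the cost of the repair. -/
def repairValue (W : Finset (Fin I.n)) (g : Fin I.m → Fin I.n)
    (f : Node I.n I.m → Node I.n I.m → ℕ) : ℚ :=
  ∑ j, I.V (g j) j - (I.repairNetwork W g).cost f

/-- `a` is a possible result of the algorithm (ties may be broken in any way): the repaired
assignment for an enumerated set of winners for which the value after the repair is largest. -/
def IsAlgorithmResult (c : ℕ) (a : Fin I.m → Fin I.n) : Prop :=
  ∃ W ∈ I.winnerSets c, ∃ g f, I.IsRepair W g f ∧
    (∀ W' ∈ I.winnerSets c, ∀ g' f', I.IsRepair W' g' f' →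
      I.repairValue W' g' f' ≤ I.repairValue W g f) ∧
    a = I.reassign g f

/-- The scheme of an assignment: the signal of a category is the name of its winner. -/
def schemeOf (a : Fin I.m → Fin I.n) (j : Fin I.m) : ℕ := a j

end Problem

/-! ## Random access machine with logarithmic cost

Programs of a structured language work on registers and on two random access memories, for
natural and for rational numbers. Every operation costs one plus the number of bits of its
operands (for a memory access: of the address and of the content), which is polynomially related
to the time of a Turing machine. -/

/-- Number of bits of a rational number: those of its numerator plus those of its denominator. -/
def ratSize (q : ℚ) : ℕ := Nat.size q.num.natAbs + Nat.size q.den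

structure State where
  reg : ℕ → ℕ
  ratReg : ℕ → ℚ
  mem : ℕ → ℕ
  ratMem : ℕ → ℚ

/-- Expressions for natural numbers; `sub` is truncated and division by zero gives zero. -/
inductive NatExp where
  | const (k : ℕ)
  | reg (x : ℕ)
  | load (addr : NatExp)
  | add (a b : NatExp)
  | sub (a b : NatExp)
  | mul (a b : NatExp)
  | div (a b : NatExp)
  | mod (a b : NatExp)

def NatExp.eval (s : State) : NatExp → ℕ
  | const k => k
  | reg x => s.reg x
  | load a => s.mem (a.eval s)
  | add a b => a.eval s + b.eval s
  | sub a b => a.eval s - b.eval s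
  | mul a b => a.eval s * b.eval s
  | div a b => a.eval s / b.eval s
  | mod a b => a.eval s % b.eval s

/-- Cost of evaluating an expression. -/
def NatExp.cost (s : State) : NatExp → ℕ
  | const k => 1 + k.size
  | reg x => 1 + (s.reg x).size
  | load a => a.cost s + 1 + (a.eval s).size + (s.mem (a.eval s)).size
  | add a b | sub a b | mul a b | div a b | mod a b =>
      a.cost s + b.cost s + 1 + (a.eval s).size + (b.eval s).size

/-- Expressions for rational numbers. -/
inductive RatExp where
  | const (q : ℚ)
  | reg (x : ℕ)
  | load (addr : NatExp)
  | add (a b : RatExp)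
  | sub (a b : RatExp)
  | mul (a b : RatExp)

def RatExp.eval (s : State) : RatExp → ℚ
  | const q => q
  | reg x => s.ratReg x
  | load a => s.ratMem (a.eval s)
  | add a b => a.eval s + b.eval s
  | sub a b => a.eval s - b.eval s
  | mul a b => a.eval s * b.eval s

def RatExp.cost (s : State) : RatExp → ℕ
  | const q => 1 + ratSize q
  | reg x => 1 + ratSize (s.ratReg x)
  | load a => a.cost s + 1 + (a.eval s).size + ratSize (s.ratMem (a.eval s))
  | add a b | sub a b | mul a b =>
      a.cost s + b.cost s + 1 + ratSize (a.eval s) + ratSize (b.eval s)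

/-- Tests. -/
inductive Test where
  | natLt (a b : NatExp)
  | natEq (a b : NatExp)
  | ratLt (a b : RatExp)

def Test.eval (s : State) : Test → Bool
  | natLt a b => decide (a.eval s < b.eval s)
  | natEq a b => decide (a.eval s = b.eval s)
  | ratLt a b => decide (a.eval s < b.eval s)

def Test.cost (s : State) : Test → ℕ
  | natLt a b | natEq a b => a.cost s + b.cost s + 1 + (a.eval s).size + (b.eval s).size
  | ratLt a b => a.cost s + b.cost s + 1 + ratSize (a.eval s) + ratSize (b.eval s)

inductive Program where
  | skip
  | setReg (x : ℕ) (e : NatExp)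
  | setRatReg (x : ℕ) (e : RatExp)
  | store (addr : NatExp) (e : NatExp)
  | storeRat (addr : NatExp) (e : RatExp)
  | seq (P Q : Program)
  | ite (b : Test) (P Q : Program)
  | while (b : Test) (P : Program)

/-- `Runs P s t s'`: started in the state `s`, the program `P` halts in the state `s'`, and the
total cost of the run is `t`. -/
inductive Runs : Program → State → ℕ → State → Prop
  | skip (s : State) : Runs .skip s 1 s
  | setReg (x : ℕ) (e : NatExp) (s : State) :
      Runs (.setReg x e) s (e.cost s + 1 + (e.eval s).size)
        { s with reg := Function.update s.reg x (e.eval s) }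
  | setRatReg (x : ℕ) (e : RatExp) (s : State) :
      Runs (.setRatReg x e) s (e.cost s + 1 + ratSize (e.eval s))
        { s with ratReg := Function.update s.ratReg x (e.eval s) }
  | store (a e : NatExp) (s : State) :
      Runs (.store a e) s (a.cost s + e.cost s + 1 + (a.eval s).size + (e.eval s).size)
        { s with mem := Function.update s.mem (a.eval s) (e.eval s) }
  | storeRat (a : NatExp) (e : RatExp) (s : State) :
      Runs (.storeRat a e) s (a.cost s + e.cost s + 1 + (a.eval s).size + ratSize (e.eval s))
        { s with ratMem := Function.update s.ratMem (a.eval s) (e.eval s) }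
  | seq {P Q : Program} {s₁ s₂ s₃ : State} {t₁ t₂ : ℕ}
      (hP : Runs P s₁ t₁ s₂) (hQ : Runs Q s₂ t₂ s₃) : Runs (.seq P Q) s₁ (t₁ + t₂) s₃
  | ite_true {b : Test} {P Q : Program} {s s' : State} {t : ℕ}
      (hb : b.eval s = true) (hP : Runs P s t s') : Runs (.ite b P Q) s (b.cost s + t) s'
  | ite_false {b : Test} {P Q : Program} {s s' : State} {t : ℕ}
      (hb : b.eval s = false) (hQ : Runs Q s t s') : Runs (.ite b P Q) s (b.cost s + t) s'
  | while_true {b : Test} {P : Program} {s₁ s₂ s₃ : State} {t₁ t₂ : ℕ}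
      (hb : b.eval s₁ = true) (hP : Runs P s₁ t₁ s₂) (hw : Runs (.while b P) s₂ t₂ s₃) :
      Runs (.while b P) s₁ (b.cost s₁ + t₁ + t₂) s₃
  | while_false {b : Test} {P : Program} {s : State}
      (hb : b.eval s = false) : Runs (.while b P) s (b.cost s) s

/-- The machine is deterministic: a program has at most one final state and one cost. -/
theorem Runs.unique {P : Program} {s s₁ s₂ : State} {t₁ t₂ : ℕ}
    (h₁ : Runs P s t₁ s₁) (h₂ : Runs P s t₂ s₂) : t₁ = t₂ ∧ s₁ = s₂ := by
  induction h₁ generalizing t₂ s₂ with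
  | skip => cases h₂; exact ⟨rfl, rfl⟩
  | setReg => cases h₂; exact ⟨rfl, rfl⟩
  | setRatReg => cases h₂; exact ⟨rfl, rfl⟩
  | store => cases h₂; exact ⟨rfl, rfl⟩
  | storeRat => cases h₂; exact ⟨rfl, rfl⟩
  | seq _ _ ih₁ ih₂ =>
    cases h₂ with
    | seq a b =>
      obtain ⟨rfl, rfl⟩ := ih₁ a
      obtain ⟨rfl, rfl⟩ := ih₂ b
      exact ⟨rfl, rfl⟩
  | ite_true hb _ ih =>
    cases h₂ with
    | ite_true _ a => obtain ⟨rfl, rfl⟩ := ih a; exact ⟨rfl, rfl⟩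
    | ite_false hb' _ => simp [hb] at hb'
  | ite_false hb _ ih =>
    cases h₂ with
    | ite_true hb' _ => simp [hb] at hb'
    | ite_false _ a => obtain ⟨rfl, rfl⟩ := ih a; exact ⟨rfl, rfl⟩
  | while_true hb _ _ ih₁ ih₂ =>
    cases h₂ with
    | while_true _ a b =>
      obtain ⟨rfl, rfl⟩ := ih₁ a
      obtain ⟨rfl, rfl⟩ := ih₂ b
      exact ⟨rfl, rfl⟩
    | while_false hb' => simp [hb] at hb'
  | while_false hb =>
    cases h₂ with
    | while_true hb' _ _ => simp [hb] at hb'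
    | while_false _ => exact ⟨rfl, rfl⟩

namespace Problem

variable (I : Problem)

/-- Input size: the number of bidders and of categories plus the bits of all the numbers. -/
def size : ℕ :=
  I.n + I.m + I.K.size + ∑ j, ratSize (I.p j) + ∑ i, ∑ j, ratSize (I.v i j)

/-- The initial state: `n`, `m`, `K` in the registers 0, 1, 2; the probabilities, then the
valuations bidder by bidder, in the rational memory; zero everywhere else. -/
def input : State where
  reg x := if x = 0 then I.n else if x = 1 then I.m else if x = 2 then I.K else 0
  ratReg _ := 0
  mem _ := 0
  ratMem x :=
    if h : x < I.m then I.p ⟨x, h⟩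
    else if h : (x - I.m) / I.m < I.n ∧ (x - I.m) % I.m < I.m then
      I.v ⟨(x - I.m) / I.m, h.1⟩ ⟨(x - I.m) % I.m, h.2⟩
    else 0

/-- The scheme that a final state holds: the signal of category `j` is in the memory cell `j`. -/
def output (s : State) (j : Fin I.m) : ℕ := s.mem j

end Problem

end KAnon

namespace KAnon

/-! ## Flows in the repair network and assignments -/

/-! Correctness of the algorithm. In a feasible integral flow for `W` and `g`, the only arc into an
item comes from its owner `g j` and has capacity one, so the flow moves each item at most once, and
to another winner. Conservation at the two copies of a bidder, with the lower bound `K` on the arc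
to `fin`, says exactly that the bidder ends with at least `K` items. The cost is the value of `g`
minus the value of the new assignment (`cost_eq`), where the value of `a` is the sum of `V (a j) j`.
Conversely every fair assignment comes from a flow (`flowOf_isFeasible`, `reassign_flowOf`).
Minimum-cost flows thus give the fair assignments of largest value, and the results of the algorithm
are precisely the admissible assignments of largest value (`isAlgorithmResult_iff`). The probability
of a signal times a posterior expectation is a plain sum of `V i j` over the support. Hence merging
signals with the same winner turns any admissible scheme into an admissible assignment whose value
is the welfare of the scheme (`exists_assignment`), while the scheme of an assignment has at least
the value of the assignment as welfare (`value_le_welfare`). Together these give optimality.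
Complexity. By this characterization the program need not compute flows: any admissible assignment
of largest value is a result. For constant `c` it is found by dynamic programming. An index `y`
fixes the winners of `c` slots and the number of items in each; its table entry is governed by a
Bellman equation on the slot of the last item (`IsTable`). Induction on the items shows that the
entry bounds the value of every placement with these counts (`sum_gain_le`), and following the
stored choices backwards attains the entry (`Traced`). There are `base ^ (2 * c)` indices,
polynomially many. For the cost, a loop-free program is linear in the bit length of the state
(`Program.exists_runs`), so each loop needs only a round count and a uniform bit bound. Rationals
are controlled through a submultiplicative height: each table round adds at most `2 * size` to the
exponent bounding the height. -/

theorem Node.sum_eq {n m : ℕ} {M : Type*} [AddCommMonoid M] (F : Node n m → M) :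
    ∑ x, F x = F .st + F .fin + ∑ i, F (.bidder i) + ∑ i, F (.bidder' i) + ∑ j, F (.item j) := by
  let e : (Unit ⊕ Unit) ⊕ (Fin n ⊕ Fin n) ⊕ Fin m ≃ Node n m :=
    { toFun := Sum.elim (Sum.elim (fun _ => .st) fun _ => .fin)
        (Sum.elim (Sum.elim .bidder .bidder') .item)
      invFun := fun x => match x with
        | .st => .inl (.inl ())
        | .fin => .inl (.inr ())
        | .bidder i => .inr (.inl (.inl i))
        | .bidder' i => .inr (.inl (.inr i))
        | .item j => .inr (.inr j)
      left_inv := by rintro ((_ | _) | (_ | _) | _) <;> rfl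
      right_inv := by rintro (_ | _ | _ | _ | _) <;> rfl }
  rw [← e.sum_comp]
  simp [e, Fintype.sum_sum_type, add_assoc]

namespace Problem

variable (I : Problem)

/-- The welfare of the assignment `a`, item by item. -/
def value (a : Fin I.m → Fin I.n) : ℚ := ∑ j, I.V (a j) j

/-- The assignment `a` gives every item to a winner and at least `K` items to every winner. -/
def IsFair (W : Finset (Fin I.n)) (a : Fin I.m → Fin I.n) : Prop :=
  (∀ j, a j ∈ W) ∧ ∀ i ∈ W, I.K ≤ (univ.filter fun j => a j = i).card

variable {I}
variable {W : Finset (Fin I.n)} {g a : Fin I.m → Fin I.n}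
  {f : Node I.n I.m → Node I.n I.m → ℕ}

/-- Balance of bidder `i`: final holding plus items given away equals initial holding plus items
gained. This is the form in which conservation at the bidder vertices is used. -/
theorem card_filter_split (a g : Fin I.m → Fin I.n) (i : Fin I.n) :
    (univ.filter fun j => a j = i).card + ∑ j, (if g j = i ∧ a j ≠ i then 1 else 0) =
      (univ.filter fun j => g j = i).card + ∑ j, (if a j = i ∧ g j ≠ i then 1 else 0) := by
  rw [card_filter, card_filter, ← sum_add_distrib, ← sum_add_distrib]
  refine sum_congr rfl fun j _ => ?_
  by_cases h : a j = i <;> by_cases h' : g j = i <;> simp [h, h']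

/-- A feasible flow moves an item exactly if the reassignment does, and to the same bidder. -/
theorem flow_item_eq (hf : (I.repairNetwork W g).IsFeasible f) (j : Fin I.m) :
    (∀ i, f (.item j) (.bidder i) = if I.reassign g f j = i ∧ g j ≠ i then 1 else 0) ∧
      ∀ i, f (.bidder' i) (.item j) = if g j = i ∧ I.reassign g f j ≠ i then 1 else 0 := by
  obtain ⟨h0, hb, hc⟩ := hf
  have hin : ∀ i, g j ≠ i → f (.bidder' i) (.item j) = 0 := fun i hi =>
    h0 _ _ (by simp [repairNetwork, repairArc, hi])
  have hout : f (.item j) (.bidder (g j)) = 0 := h0 _ _ (by simp [repairNetwork, repairArc])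
  have hle : f (.bidder' (g j)) (.item j) ≤ 1 := by
    by_cases hW : g j ∈ W
    · have : (f (.bidder' (g j)) (.item j) : ℕ∞) ≤ 1 :=
        (hb (.bidder' (g j)) (.item j) ⟨0, 1, I.V (g j) j⟩
        (by simp [repairNetwork, repairArc, hW])).2
      exact_mod_cast this
    · rw [h0 _ _ (by simp [repairNetwork, repairArc, hW])]; exact zero_le_one
  have hcons := hc (.item j) (by simp [repairNetwork]) (by simp [repairNetwork])
  rw [Node.sum_eq, Node.sum_eq] at hcons
  have z1 : f .st (.item j) = 0 := h0 _ _ rfl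
  have z2 : f .fin (.item j) = 0 := h0 _ _ rfl
  have z3 : ∀ i, f (.bidder i) (.item j) = 0 := fun i => h0 _ _ rfl
  have z4 : ∀ j', f (.item j') (.item j) = 0 := fun i => h0 _ _ rfl
  have z5 : f (.item j) .st = 0 := h0 _ _ rfl
  have z6 : f (.item j) .fin = 0 := h0 _ _ rfl
  have z7 : ∀ i, f (.item j) (.bidder' i) = 0 := fun i => h0 _ _ rfl
  have z8 : ∀ j', f (.item j) (.item j') = 0 := fun i => h0 _ _ rfl
  simp only [z1, z2, z3, z4, z5, z6, z7, z8, sum_const_zero, add_zero, zero_add] at hcons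
  -- Conservation now equates the single inflow, at most one, with the total outflow to bidders.
  rw [Fintype.sum_eq_single (g j) fun i hi => hin i hi.symm] at hcons
  by_cases h : ∃ i, 0 < f (.item j) (.bidder i)
  · have hr : I.reassign g f j = h.choose := by simp [reassign, h]
    set r := I.reassign g f j with hrdef
    have hpos : 0 < f (.item j) (.bidder r) := by rw [hr]; exact h.choose_spec
    have hrg : g j ≠ r := fun he => by rw [← he, hout] at hpos; exact lt_irrefl _ hpos
    have hsum := Finset.sum_erase_add univ (fun i => f (.item j) (.bidder i)) (mem_univ r)
    have hz : ∑ i ∈ univ.erase r, f (.item j) (.bidder i) = 0 := by omega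
    have hone : f (.item j) (.bidder r) = 1 := by omega
    rw [sum_eq_zero_iff] at hz
    constructor
    · intro i
      by_cases hi : r = i
      · subst hi; simp [hone, hrg]
      · simp [hi, hz i (by simp [Ne.symm hi])]
    · intro i
      by_cases hi : g j = i
      · subst hi; simp [Ne.symm hrg]; omega
      · simp [hi, hin i hi]
  · have hr : I.reassign g f j = g j := by simp only [reassign, h, dif_neg, not_false_iff]
    push Not at h
    have hz : ∀ i, f (.item j) (.bidder i) = 0 := fun i => Nat.le_zero.mp (h i)
    simp only [hz, sum_const_zero] at hcons
    constructor
    · intro i; rw [hz, hr]; simp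
    · intro i
      rw [hr]
      by_cases hi : g j = i
      · subst hi; simp [hcons]
      · simp [hi, hin i hi]

theorem reassign_mem (hg : I.IsBestAssignment W g) (hf : (I.repairNetwork W g).IsFeasible f)
    (j : Fin I.m) : I.reassign g f j ∈ W := by
  by_cases h : ∃ i, 0 < f (.item j) (.bidder i)
  · have hr : I.reassign g f j = h.choose := by simp [reassign, h]
    by_contra hW
    have hz : f (.item j) (.bidder (I.reassign g f j)) = 0 :=
      hf.1 _ _ (by simp [repairNetwork, repairArc, hW])
    rw [hr] at hz
    exact h.choose_spec.ne' hz
  · have hr : I.reassign g f j = g j := by simp only [reassign, h, dif_neg, not_false_iff]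
    rw [hr]; exact (hg j).1

/-- Eliminating the flow from `bidder i` to `bidder' i` between the two conservation laws leaves the
flow into `fin` equal to the final holding of `i`, and that flow is at least `K`. -/
theorem isFair_reassign (hg : I.IsBestAssignment W g) (hf : (I.repairNetwork W g).IsFeasible f) :
    I.IsFair W (I.reassign g f) := by
  refine ⟨reassign_mem hg hf, fun i hi => ?_⟩
  have hitem := flow_item_eq hf
  obtain ⟨h0, hb, hc⟩ := hf
  have hst : f .st (.bidder i) = (univ.filter fun j => g j = i).card := by
    have := hb .st (.bidder i) ⟨(univ.filter fun j => g j = i).card,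
      (univ.filter fun j => g j = i).card, 0⟩ (by simp [repairNetwork, repairArc, hi])
    exact le_antisymm (Nat.cast_le.1 this.2) this.1
  have hend : I.K ≤ f (.bidder' i) .fin :=
    (hb (.bidder' i) .fin ⟨I.K, ⊤, 0⟩ (by simp [repairNetwork, repairArc, hi])).1
  have c1 := hc (.bidder i) (by simp [repairNetwork]) (by simp [repairNetwork])
  have c2 := hc (.bidder' i) (by simp [repairNetwork]) (by simp [repairNetwork])
  rw [Node.sum_eq, Node.sum_eq] at c1 c2
  have y1 : f .fin (.bidder i) = 0 := h0 _ _ rfl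
  have y2 : ∀ i', f (.bidder i') (.bidder i) = 0 := fun _ => h0 _ _ rfl
  have y3 : ∀ i', f (.bidder' i') (.bidder i) = 0 := fun _ => h0 _ _ rfl
  have y4 : f (.bidder i) .st = 0 := h0 _ _ rfl
  have y5 : f (.bidder i) .fin = 0 := h0 _ _ rfl
  have y6 : ∀ i', f (.bidder i) (.bidder i') = 0 := fun _ => h0 _ _ rfl
  have y7 : ∀ j, f (.bidder i) (.item j) = 0 := fun _ => h0 _ _ rfl
  have y8 : ∀ i', i' ≠ i → f (.bidder i) (.bidder' i') = 0 := fun i' h =>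
    h0 _ _ (by simp [repairNetwork, repairArc, h])
  have z1 : f .st (.bidder' i) = 0 := h0 _ _ rfl
  have z2 : f .fin (.bidder' i) = 0 := h0 _ _ rfl
  have z3 : ∀ i', f (.bidder' i') (.bidder' i) = 0 := fun _ => h0 _ _ rfl
  have z4 : ∀ j, f (.item j) (.bidder' i) = 0 := fun _ => h0 _ _ rfl
  have z5 : f (.bidder' i) .st = 0 := h0 _ _ rfl
  have z6 : ∀ i', f (.bidder' i) (.bidder i') = 0 := fun _ => h0 _ _ rfl
  have z7 : ∀ i', f (.bidder' i) (.bidder' i') = 0 := fun _ => h0 _ _ rfl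
  have z8 : ∀ i', i' ≠ i → f (.bidder i') (.bidder' i) = 0 := fun i' h =>
    h0 _ _ (by simp [repairNetwork, repairArc, Ne.symm h])
  rw [Fintype.sum_eq_single i y8] at c1
  rw [Fintype.sum_eq_single i z8] at c2
  simp only [y1, y2, y3, y4, y5, y6, y7, z1, z2, z3, z4, z5, z6, z7, sum_const_zero, add_zero,
    zero_add, hst, fun j => (hitem j).1 i, fun j => (hitem j).2 i] at c1 c2
  have := card_filter_split (I.reassign g f) g i
  omega

/-- Only arcs at items carry a cost, and each moved item contributes its old value minus its new
one. -/
theorem cost_eq (hg : I.IsBestAssignment W g) (hf : (I.repairNetwork W g).IsFeasible f) :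
    (I.repairNetwork W g).cost f = I.value g - I.value (I.reassign g f) := by
  have hitem := flow_item_eq hf
  have hmem := reassign_mem hg hf
  have hbid : ∀ i y, (I.repairNetwork W g).unitCost (.bidder i) y = 0 := by
    intro i y
    cases y <;> simp [Network.unitCost, repairNetwork, repairArc]
    split_ifs <;> simp
  have hst : ∀ y, (I.repairNetwork W g).unitCost .st y = 0 := by
    intro y
    cases y <;> simp [Network.unitCost, repairNetwork, repairArc]
    split_ifs <;> simp
  have hfin : ∀ y, (I.repairNetwork W g).unitCost .fin y = 0 := by
    intro y
    cases y <;> simp [Network.unitCost, repairNetwork, repairArc]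
  have hb'fin : ∀ i, (I.repairNetwork W g).unitCost (.bidder' i) .fin = 0 := by
    intro i
    simp only [Network.unitCost, repairNetwork, repairArc]
    split_ifs <;> simp
  have e1 : ∀ j i, (f (.item j) (.bidder i) : ℚ) *
      (I.repairNetwork W g).unitCost (.item j) (.bidder i) =
      if I.reassign g f j = i then (if g j ≠ i then -I.V i j else 0) else 0 := by
    intro j i
    rw [(hitem j).1 i]
    by_cases h1 : I.reassign g f j = i <;> by_cases h2 : g j = i <;>
      simp [h1, h2, Network.unitCost, repairNetwork, repairArc]
    simp [h1 ▸ hmem j]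
  have e2 : ∀ i j, (f (.bidder' i) (.item j) : ℚ) *
      (I.repairNetwork W g).unitCost (.bidder' i) (.item j) =
      if g j = i then (if I.reassign g f j ≠ i then I.V i j else 0) else 0 := by
    intro i j
    rw [(hitem j).2 i]
    by_cases h1 : I.reassign g f j = i <;> by_cases h2 : g j = i <;>
      simp [h1, h2, Network.unitCost, repairNetwork, repairArc]
    simp [h2 ▸ (hg j).1]
  have u1 : ∀ i, (I.repairNetwork W g).unitCost (.bidder' i) .st = 0 := fun _ => rfl
  have u2 : ∀ i i', (I.repairNetwork W g).unitCost (.bidder' i) (.bidder i') = 0 :=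
    fun _ _ => rfl
  have u3 : ∀ i i', (I.repairNetwork W g).unitCost (.bidder' i) (.bidder' i') = 0 :=
    fun _ _ => rfl
  have u4 : ∀ j, (I.repairNetwork W g).unitCost (.item j) .st = 0 := fun _ => rfl
  have u5 : ∀ j, (I.repairNetwork W g).unitCost (.item j) .fin = 0 := fun _ => rfl
  have u6 : ∀ j i', (I.repairNetwork W g).unitCost (.item j) (.bidder' i') = 0 :=
    fun _ _ => rfl
  have u7 : ∀ j j', (I.repairNetwork W g).unitCost (.item j) (.item j') = 0 :=
    fun _ _ => rfl
  unfold Network.cost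
  rw [Node.sum_eq]
  simp only [hst, hbid, hfin, mul_zero, sum_const_zero, add_zero, zero_add]
  simp only [Node.sum_eq, e1, e2, hb'fin, u1, u2, u3, u4, u5, u6, u7, mul_zero, sum_const_zero,
    add_zero, zero_add]
  rw [sum_comm, value, value, ← sum_add_distrib, ← sum_sub_distrib]
  refine sum_congr rfl fun j _ => ?_
  rw [sum_ite_eq univ (g j) fun i => if I.reassign g f j ≠ i then I.V i j else 0,
    sum_ite_eq univ (I.reassign g f j) fun i => if g j ≠ i then -I.V i j else 0]
  by_cases h : I.reassign g f j = g j
  · simp [h]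
  · simp [h, Ne.symm h, sub_eq_add_neg]

theorem repairValue_eq (hg : I.IsBestAssignment W g)
    (hf : (I.repairNetwork W g).IsFeasible f) :
    I.repairValue W g f = I.value (I.reassign g f) := by
  rw [repairValue, cost_eq hg hf, value, value]; ring

variable (I) in
/-- The flow that turns the assignment `g` into `a`. -/
def flowOf (g a : Fin I.m → Fin I.n) : Node I.n I.m → Node I.n I.m → ℕ
  | .st, .bidder i => (univ.filter fun j => g j = i).card
  | .bidder i, .bidder' i' => if i' = i then (univ.filter fun j => g j = i).card +
      ∑ j, (if a j = i ∧ g j ≠ i then 1 else 0) else 0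
  | .bidder' i, .fin => (univ.filter fun j => a j = i).card
  | .bidder' i, .item j => if g j = i ∧ a j ≠ i then 1 else 0
  | .item j, .bidder i => if a j = i ∧ g j ≠ i then 1 else 0
  | _, _ => 0

theorem flowOf_isFeasible (hg : ∀ j, g j ∈ W) (ha : I.IsFair W a) :
    (I.repairNetwork W g).IsFeasible (I.flowOf g a) := by
  have hcard : ∀ (b : Fin I.m → Fin I.n), (∀ j, b j ∈ W) → ∀ i, i ∉ W → ∀ j, b j ≠ i :=
    fun b hb i hi j h => hi (h ▸ hb j)
  refine ⟨?_, ?_, ?_⟩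
  · intro x y h
    cases x <;> cases y <;> simp [repairNetwork, repairArc] at h <;> simp [flowOf]
    case st.bidder i => exact hcard g hg i h
    case bidder.bidder' i i' =>
      intro hi
      subst hi
      have hi : i' ∉ W := fun hW => h hW rfl
      exact ⟨hcard g hg _ hi, fun j hj => absurd hj (hcard a ha.1 _ hi j)⟩
    case bidder'.fin i => exact hcard a ha.1 i h
    case bidder'.item i j => intro hi; exact absurd hi (h (hi ▸ hg j))
    case item.bidder j i =>
      intro hi
      exact h (hi ▸ ha.1 j)
  · intro x y e h
    cases x <;> cases y <;> simp [repairNetwork, repairArc] at h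
    case st.bidder i => obtain ⟨h, rfl⟩ := h; simp [flowOf]
    case bidder.bidder' i i' => obtain ⟨h, rfl⟩ := h; simp
    case bidder'.fin i => obtain ⟨h, rfl⟩ := h; simpa [flowOf] using ha.2 i h
    case bidder'.item i j =>
      obtain ⟨h, rfl⟩ := h
      simp only [flowOf]
      split_ifs <;> simp
    case item.bidder j i =>
      obtain ⟨h, rfl⟩ := h
      simp only [flowOf]
      split_ifs <;> simp
  · intro x hx hx'
    rw [Node.sum_eq, Node.sum_eq]
    cases x
    case st => simp [repairNetwork] at hx
    case fin => simp [repairNetwork] at hx'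
    case bidder i => simp [flowOf]
    case bidder' i =>
      have := card_filter_split a g i
      simp only [flowOf, sum_const_zero, add_zero, zero_add, sum_ite_eq, mem_univ, if_true]
      exact this.symm
    case item j =>
      simp only [flowOf, sum_const_zero, add_zero, zero_add]
      have h1 : ∀ b c : Fin I.n,
          ∑ i, (if b = i ∧ c ≠ i then 1 else 0) = if c ≠ b then 1 else 0 := by
        intro b c
        rw [Fintype.sum_eq_single b]
        · simp
        · intro i hi; simp [Ne.symm hi]
      rw [h1, h1]
      simp [eq_comm]

theorem reassign_flowOf : I.reassign g (I.flowOf g a) = a := by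
  funext j
  by_cases h : ∃ i, 0 < I.flowOf g a (.item j) (.bidder i)
  · have hr : I.reassign g (I.flowOf g a) j = h.choose := by
      unfold reassign; rw [dif_pos h]
    have := h.choose_spec
    rw [← hr] at this
    simp only [flowOf] at this
    by_contra hne
    simp [Ne.symm hne] at this
  · have hr : I.reassign g (I.flowOf g a) j = g j := by
      unfold reassign; rw [dif_neg h]
    rw [hr]
    by_contra hne
    exact h ⟨a j, by simp [flowOf, hne]⟩

/-! ## Results of the algorithm -/

theorem exists_isBestAssignment (hW : W.Nonempty) : ∃ g, I.IsBestAssignment W g := by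
  choose g hg using fun j => W.exists_max_image (fun i => I.V i j) hW
  exact ⟨g, hg⟩

theorem support_schemeOf (a : Fin I.m → Fin I.n) (i : Fin I.n) :
    I.support (I.schemeOf a) i = univ.filter fun j => a j = i := by
  ext j; simp [support, schemeOf, Fin.val_inj]

theorem signals_schemeOf (a : Fin I.m → Fin I.n) :
    I.signals (I.schemeOf a) = (univ.image a).map Fin.valEmbedding := by
  ext S; simp [signals, schemeOf]

theorem isAdmissible_schemeOf {c : ℕ} :
    I.IsAdmissible c (I.schemeOf a) ↔
      (univ.image a).card ≤ c ∧ ∀ j, I.K ≤ (univ.filter fun j' => a j' = a j).card := by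
  rw [IsAdmissible, signals_schemeOf, card_map]
  refine and_congr_right fun _ => ?_
  simp [support_schemeOf]

theorem IsFair.isAdmissible {c : ℕ} (ha : I.IsFair W a) (hW : W.card ≤ c) :
    I.IsAdmissible c (I.schemeOf a) := by
  refine isAdmissible_schemeOf.2 ⟨le_trans (card_le_card fun i hi => ?_) hW,
    fun j => ha.2 _ (ha.1 j)⟩
  obtain ⟨j, -, rfl⟩ := mem_image.1 hi
  exact ha.1 j

theorem items_pos (I : Problem) : 0 < I.m := by
  by_contra h
  have hm : I.m = 0 := by omega
  have : IsEmpty (Fin I.m) := by rw [hm]; infer_instance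
  have := I.p_sum
  simp at this

theorem isFair_image {c : ℕ} (ha : I.IsAdmissible c (I.schemeOf a)) :
    univ.image a ∈ I.winnerSets c ∧ I.IsFair (univ.image a) a := by
  rw [isAdmissible_schemeOf] at ha
  refine ⟨?_, fun j => mem_image_of_mem _ (mem_univ _), fun i hi => ?_⟩
  · simp only [winnerSets, mem_filter, mem_univ, true_and]
    exact ⟨⟨a ⟨0, I.items_pos⟩, mem_image_of_mem _ (mem_univ _)⟩, ha.1⟩
  · obtain ⟨j, -, rfl⟩ := mem_image.1 hi
    exact ha.2 j

/-- This removes flows and winner sets from the rest of the proof. An admissible assignment is fair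
for the set of bidders it actually uses, so maximizing over enumerated sets and then over fair
assignments is maximizing over all admissible assignments. -/
theorem isAlgorithmResult_iff {c : ℕ} :
    I.IsAlgorithmResult c a ↔ I.IsAdmissible c (I.schemeOf a) ∧
      ∀ b, I.IsAdmissible c (I.schemeOf b) → I.value b ≤ I.value a := by
  constructor
  · rintro ⟨W, hW, g, f, hr, hmax, rfl⟩
    have hc : W.card ≤ c := (mem_filter.1 hW).2.2
    refine ⟨(isFair_reassign hr.1 hr.2.1).isAdmissible hc, fun b hb => ?_⟩
    obtain ⟨hW', hb'⟩ := isFair_image hb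
    -- `IsRepair` demands a minimum-cost flow, so `b` is replaced by a fair assignment of largest
    -- value for the same winners.
    obtain ⟨b', hb'm, hb'max⟩ := Set.exists_max_image {b' | I.IsFair (univ.image b) b'} I.value
      (Set.toFinite _) ⟨b, hb'⟩
    obtain ⟨g', hg'⟩ := exists_isBestAssignment (mem_filter.1 hW').2.1
    have hfeas := flowOf_isFeasible (fun j => (hg' j).1) hb'm
    have hrep : I.IsRepair (univ.image b) g' (I.flowOf g' b') := by
      refine ⟨hg', hfeas, fun f' hf' => ?_⟩
      rw [cost_eq hg' hfeas, cost_eq hg' hf', reassign_flowOf]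
      exact sub_le_sub_left (hb'max _ (isFair_reassign hg' hf')) _
    have := hmax _ hW' _ _ hrep
    rw [repairValue_eq hg' hfeas, repairValue_eq hr.1 hr.2.1, reassign_flowOf] at this
    exact (hb'max b hb').trans this
  · rintro ⟨ha, hmax⟩
    obtain ⟨hW, hfair⟩ := isFair_image ha
    obtain ⟨g, hg⟩ := exists_isBestAssignment (mem_filter.1 hW).2.1
    have hfeas := flowOf_isFeasible (fun j => (hg j).1) hfair
    refine ⟨_, hW, g, I.flowOf g a, ⟨hg, hfeas, fun f' hf' => ?_⟩, ?_, reassign_flowOf.symm⟩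
    · rw [cost_eq hg hfeas, cost_eq hg hf', reassign_flowOf]
      exact sub_le_sub_left (hmax _ ((isFair_reassign hg hf').isAdmissible
        (mem_filter.1 hW).2.2)) _
    · intro W' hW' g' f' hr
      rw [repairValue_eq hg hfeas, repairValue_eq hr.1 hr.2.1, reassign_flowOf]
      exact hmax _ ((isFair_reassign hr.1 hr.2.1).isAdmissible (mem_filter.1 hW').2.2)

/-! ### Welfare of schemes and value of assignments -/

theorem prob_mul_condValue (φ : Fin I.m → ℕ) (S : ℕ) (i : Fin I.n) :
    I.prob φ S * I.condValue φ S i = ∑ j ∈ I.support φ S, I.V i j := by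
  rw [condValue, mul_sum]
  refine sum_congr rfl fun j hj => ?_
  rw [V]
  -- For a signal of probability zero the division is meaningless, but nonnegativity makes every
  -- prior in its support zero, so both sides vanish.
  by_cases h : I.prob φ S = 0
  · rw [(sum_eq_zero_iff_of_nonneg fun j _ => I.p_nonneg j).1 h j hj]; simp
  · field_simp

theorem prob_nonneg (φ : Fin I.m → ℕ) (S : ℕ) : 0 ≤ I.prob φ S :=
  sum_nonneg fun j _ => I.p_nonneg j

theorem value_le_welfare (a : Fin I.m → Fin I.n) : I.value a ≤ I.welfare (I.schemeOf a) := by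
  rw [value, welfare, ← sum_fiberwise_of_maps_to (s := univ) (t := I.signals (I.schemeOf a))
    (g := I.schemeOf a) fun j _ => mem_image_of_mem _ (mem_univ j)]
  refine sum_le_sum fun S hS => ?_
  obtain ⟨j, -, rfl⟩ := mem_image.1 hS
  calc ∑ j' with I.schemeOf a j' = I.schemeOf a j, I.V (a j') j'
      = ∑ j' ∈ I.support (I.schemeOf a) (I.schemeOf a j), I.V (a j) j' := by
        refine sum_congr rfl fun j' hj' => ?_
        have : a j' = a j := Fin.val_injective (mem_filter.1 hj').2
        rw [this]
    _ = _ := (prob_mul_condValue _ _ _).symm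
    _ ≤ _ := mul_le_mul_of_nonneg_left (le_sup' (I.condValue _ _) (mem_univ _)) (prob_nonneg _ _)

/-- Merging the signals that have the same winner yields an assignment. -/
theorem exists_assignment {c : ℕ} {φ : Fin I.m → ℕ} (hφ : I.IsAdmissible c φ) :
    ∃ a, I.IsAdmissible c (I.schemeOf a) ∧ I.welfare φ = I.value a := by
  choose w _ hw using fun S => exists_mem_eq_sup' I.bidders_nonempty (I.condValue φ S)
  refine ⟨fun j => w (φ j), isAdmissible_schemeOf.2 ⟨?_, fun j => ?_⟩, ?_⟩
  · have : (univ.image fun j => w (φ j)) = (I.signals φ).image w := by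
      rw [signals, image_image]; rfl
    rw [this]
    exact card_image_le.trans hφ.1
  · refine (hφ.2 (φ j) (mem_image_of_mem _ (mem_univ j))).trans (card_le_card fun j' hj' => ?_)
    have : φ j' = φ j := (mem_filter.1 hj').2
    simp [this]
  · rw [value, welfare, ← sum_fiberwise_of_maps_to (s := univ) (t := I.signals φ)
      (g := φ) fun j _ => mem_image_of_mem _ (mem_univ j)]
    refine sum_congr rfl fun S _ => ?_
    rw [topValue, hw, prob_mul_condValue]
    refine sum_congr rfl fun j hj => ?_
    rw [(mem_filter.1 hj).2]

theorem IsAlgorithmResult.isOptimal {c : ℕ} (ha : I.IsAlgorithmResult c a) :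
    I.IsOptimal c (I.schemeOf a) := by
  rw [isAlgorithmResult_iff] at ha
  refine ⟨ha.1, fun ψ hψ => ?_⟩
  obtain ⟨b, hb, hbv⟩ := exists_assignment hψ
  rw [hbv]
  exact (ha.2 b hb).trans (value_le_welfare a)

theorem exists_isAlgorithmResult_iff (I : Problem) (c : ℕ) :
    (∃ a, I.IsAlgorithmResult c a) ↔ ∃ φ, I.IsAdmissible c φ := by
  constructor
  · rintro ⟨a, ha⟩
    exact ⟨_, ha.isOptimal.1⟩
  · rintro ⟨φ, hφ⟩
    obtain ⟨b, hb, -⟩ := exists_assignment hφ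
    obtain ⟨a, ha, hmax⟩ := Set.exists_max_image {a | I.IsAdmissible c (I.schemeOf a)} I.value
      (Set.toFinite _) ⟨b, hb⟩
    exact ⟨a, isAlgorithmResult_iff.2 ⟨ha, hmax⟩⟩

/-- Each enumerated set is the image of a map from `Fin c`: list its elements and repeat one of them
in the remaining places. -/
theorem card_winnerSets_le (I : Problem) (c : ℕ) : (I.winnerSets c).card ≤ I.n ^ c := by
  have h : I.winnerSets c ⊆ univ.image fun w : Fin c → Fin I.n => univ.image w := by
    intro W hW
    obtain ⟨-, ⟨i₀, hi₀⟩, hc⟩ := mem_filter.1 hW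
    have e := W.equivFin
    refine mem_image.2 ⟨fun k => if h : (k : ℕ) < W.card then (e.symm ⟨k, h⟩ : Fin I.n) else i₀,
      mem_univ _, ?_⟩
    ext i
    simp only [mem_image, mem_univ, true_and]
    constructor
    · rintro ⟨k, rfl⟩
      split_ifs
      · exact Subtype.property _
      · exact hi₀
    · intro hi
      exact ⟨⟨e ⟨i, hi⟩, (e ⟨i, hi⟩).2.trans_le hc⟩, by simp⟩
  refine (card_le_card h).trans (card_image_le.trans ?_)
  simp

end Problem

/-! ## Sizes of numbers -/

theorem size_le_self (a : ℕ) : a.size ≤ a := Nat.size_le.2 Nat.lt_two_pow_self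

theorem size_add_le (a b : ℕ) : (a + b).size ≤ a.size + b.size + 1 := by
  rw [Nat.size_le]
  have ha := Nat.lt_size_self a
  have hb := Nat.lt_size_self b
  have h1 : 2 ^ a.size ≤ 2 ^ (a.size + b.size) := Nat.pow_le_pow_right two_pos (by omega)
  have h2 : 2 ^ b.size ≤ 2 ^ (a.size + b.size) := Nat.pow_le_pow_right two_pos (by omega)
  rw [pow_succ]
  omega

theorem size_mul_le (a b : ℕ) : (a * b).size ≤ a.size + b.size := by
  rw [Nat.size_le, pow_add]
  exact Nat.mul_lt_mul'' (Nat.lt_size_self a) (Nat.lt_size_self b)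

/-- The height of a rational number, which is submultiplicative for sums and products. -/
def ratHeight (q : ℚ) : ℕ := q.num.natAbs + q.den

/-- Numerator and denominator of the unreduced sum are bounded by distinct terms of the expanded
product of heights, and reduction only shrinks them. Unlike `ratSize`, whose one-step bound carries
a factor two, this can be iterated over many summands. -/
theorem ratHeight_add_le (a b : ℚ) : ratHeight (a + b) ≤ ratHeight a * ratHeight b := by
  have hd : (a + b).den ≤ a.den * b.den := by
    exact Nat.le_of_dvd (Nat.mul_pos a.pos b.pos) (Rat.add_den_dvd a b)
  have hn : (a + b).num.natAbs ≤ a.num.natAbs * b.den + b.num.natAbs * a.den := by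
    have h := Rat.add_num_den' a b
    have h' : ((a + b).num * a.den * b.den).natAbs =
        ((a.num * b.den + b.num * a.den) * (a + b).den).natAbs := congrArg _ h
    simp only [Int.natAbs_mul, Int.natAbs_natCast] at h'
    have h2 : (a.num * b.den + b.num * a.den).natAbs ≤
        a.num.natAbs * b.den + b.num.natAbs * a.den :=
      (Int.natAbs_add_le _ _).trans (by simp [Int.natAbs_mul])
    have h3 : (a + b).num.natAbs * (a + b).den ≤
        (a.num * b.den + b.num * a.den).natAbs * (a + b).den := by
      rw [← h', mul_assoc]
      exact Nat.mul_le_mul_left _ hd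
    exact (Nat.le_of_mul_le_mul_right h3 (a + b).pos).trans h2
  unfold ratHeight
  nlinarith [Nat.zero_le (a.num.natAbs * b.num.natAbs)]

theorem ratHeight_mul_le (a b : ℚ) : ratHeight (a * b) ≤ ratHeight a * ratHeight b := by
  have hd : (a * b).den ≤ a.den * b.den :=
    Nat.le_of_dvd (Nat.mul_pos a.pos b.pos) (Rat.mul_den_dvd a b)
  have hn : (a * b).num.natAbs ≤ a.num.natAbs * b.num.natAbs := by
    have h := Rat.mul_num_den' a b
    have h' : ((a * b).num * a.den * b.den).natAbs =
        (a.num * b.num * (a * b).den).natAbs := congrArg _ h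
    simp only [Int.natAbs_mul, Int.natAbs_natCast] at h'
    have h3 : (a * b).num.natAbs * (a * b).den ≤
        a.num.natAbs * b.num.natAbs * (a * b).den := by
      rw [← h', mul_assoc]
      exact Nat.mul_le_mul_left _ hd
    exact Nat.le_of_mul_le_mul_right h3 (a * b).pos
  unfold ratHeight
  nlinarith [Nat.zero_le (a.num.natAbs * b.den), Nat.zero_le (b.num.natAbs * a.den)]

theorem ratHeight_neg (a : ℚ) : ratHeight (-a) = ratHeight a := by simp [ratHeight]

theorem ratHeight_sub_le (a b : ℚ) : ratHeight (a - b) ≤ ratHeight a * ratHeight b := by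
  rw [sub_eq_add_neg, ← ratHeight_neg b]
  exact ratHeight_add_le _ _

theorem ratHeight_le_two_pow (q : ℚ) : ratHeight q ≤ 2 ^ ratSize q := by
  unfold ratHeight ratSize
  have hn := Nat.lt_size_self q.num.natAbs
  have hd := Nat.lt_size_self q.den
  have h := Nat.mul_le_mul hn hd
  rw [pow_add]
  refine le_trans ?_ h
  simp only [Nat.succ_eq_add_one, add_mul, mul_add, one_mul, mul_one]
  omega

theorem ratSize_le_of_height {q : ℚ} {k : ℕ} (h : ratHeight q ≤ 2 ^ k) :
    ratSize q ≤ 2 * k + 2 := by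
  unfold ratHeight at h
  have h2 : 2 ^ k < 2 ^ (k + 1) := Nat.pow_lt_pow_right one_lt_two (Nat.lt_succ_self k)
  have hn : q.num.natAbs.size ≤ k + 1 := Nat.size_le.2 (by omega)
  have hd : q.den.size ≤ k + 1 := Nat.size_le.2 (by omega)
  unfold ratSize
  omega

theorem ratSize_le_of_height_mul {a b q : ℚ} (h : ratHeight q ≤ ratHeight a * ratHeight b) :
    ratSize q ≤ 2 * (ratSize a + ratSize b) + 2 :=
  ratSize_le_of_height (by
    rw [pow_add]
    exact h.trans (Nat.mul_le_mul (ratHeight_le_two_pow a) (ratHeight_le_two_pow b)))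

/-! ## Cost of programs without loops -/

/-- All numbers that the state holds have at most `L` bits. -/
structure State.Bounded (L : ℕ) (s : State) : Prop where
  reg : ∀ x, (s.reg x).size ≤ L
  ratReg : ∀ x, ratSize (s.ratReg x) ≤ L
  mem : ∀ x, (s.mem x).size ≤ L
  ratMem : ∀ x, ratSize (s.ratMem x) ≤ L

theorem State.Bounded.mono {L L' : ℕ} {s : State} (h : s.Bounded L) (hL : L ≤ L') :
    s.Bounded L' :=
  ⟨fun x => (h.reg x).trans hL, fun x => (h.ratReg x).trans hL, fun x => (h.mem x).trans hL,
    fun x => (h.ratMem x).trans hL⟩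

/-- Bit lengths add, up to a constant, under every operation. A fixed expression therefore has size
and cost linear in `L`, with a factor that depends on the expression alone. -/
theorem NatExp.exists_bound (e : NatExp) :
    ∃ k, ∀ L s, State.Bounded L s → (e.eval s).size ≤ k * (L + 1) ∧ e.cost s ≤ k * (L + 1) := by
  induction e with
  | const n => exact ⟨1 + n.size, fun L s _ => by simp only [eval, cost]; constructor <;> nlinarith⟩
  | reg x =>
    refine ⟨1, fun L s h => ?_⟩
    have := h.reg x
    simp only [eval, cost]; omega
  | load a ih =>
    obtain ⟨k, hk⟩ := ih
    refine ⟨2 * k + 1, fun L s h => ?_⟩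
    have := h.mem (a.eval s)
    have := hk L s h
    simp only [eval, cost]
    constructor <;> nlinarith
  | add a b iha ihb =>
    obtain ⟨k, hk⟩ := iha
    obtain ⟨l, hl⟩ := ihb
    refine ⟨2 * k + 2 * l + 1, fun L s h => ?_⟩
    have := hk L s h
    have := hl L s h
    have := size_add_le (a.eval s) (b.eval s)
    simp only [eval, cost]
    constructor <;> nlinarith
  | sub a b iha ihb =>
    obtain ⟨k, hk⟩ := iha
    obtain ⟨l, hl⟩ := ihb
    refine ⟨2 * k + 2 * l + 1, fun L s h => ?_⟩
    have := hk L s h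
    have := hl L s h
    have := Nat.size_le_size (Nat.sub_le (a.eval s) (b.eval s))
    simp only [eval, cost]
    constructor <;> nlinarith
  | mul a b iha ihb =>
    obtain ⟨k, hk⟩ := iha
    obtain ⟨l, hl⟩ := ihb
    refine ⟨2 * k + 2 * l + 1, fun L s h => ?_⟩
    have := hk L s h
    have := hl L s h
    have := size_mul_le (a.eval s) (b.eval s)
    simp only [eval, cost]
    constructor <;> nlinarith
  | div a b iha ihb =>
    obtain ⟨k, hk⟩ := iha
    obtain ⟨l, hl⟩ := ihb
    refine ⟨2 * k + 2 * l + 1, fun L s h => ?_⟩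
    have := hk L s h
    have := hl L s h
    have := Nat.size_le_size (Nat.div_le_self (a.eval s) (b.eval s))
    simp only [eval, cost]
    constructor <;> nlinarith
  | mod a b iha ihb =>
    obtain ⟨k, hk⟩ := iha
    obtain ⟨l, hl⟩ := ihb
    refine ⟨2 * k + 2 * l + 1, fun L s h => ?_⟩
    have := hk L s h
    have := hl L s h
    have := Nat.size_le_size (Nat.mod_le (a.eval s) (b.eval s))
    simp only [eval, cost]
    constructor <;> nlinarith

theorem RatExp.exists_bound (e : RatExp) :
    ∃ k, ∀ L s, State.Bounded L s → ratSize (e.eval s) ≤ k * (L + 1) ∧ e.cost s ≤ k * (L + 1) := by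
  induction e with
  | const n =>
    exact ⟨1 + ratSize n, fun L s _ => by simp only [eval, cost]; constructor <;> nlinarith⟩
  | reg x =>
    refine ⟨1, fun L s h => ?_⟩
    have := h.ratReg x
    simp only [eval, cost]; omega
  | load a =>
    obtain ⟨k, hk⟩ := a.exists_bound
    refine ⟨2 * k + 1, fun L s h => ?_⟩
    have := h.ratMem (a.eval s)
    have := hk L s h
    simp only [eval, cost]
    constructor <;> nlinarith
  | add a b iha ihb =>
    obtain ⟨k, hk⟩ := iha
    obtain ⟨l, hl⟩ := ihb
    refine ⟨2 * k + 2 * l + 2, fun L s h => ?_⟩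
    have := hk L s h
    have := hl L s h
    have := ratSize_le_of_height_mul (ratHeight_add_le (a.eval s) (b.eval s))
    simp only [eval, cost]
    constructor <;> nlinarith
  | sub a b iha ihb =>
    obtain ⟨k, hk⟩ := iha
    obtain ⟨l, hl⟩ := ihb
    refine ⟨2 * k + 2 * l + 2, fun L s h => ?_⟩
    have := hk L s h
    have := hl L s h
    have := ratSize_le_of_height_mul (ratHeight_sub_le (a.eval s) (b.eval s))
    simp only [eval, cost]
    constructor <;> nlinarith
  | mul a b iha ihb =>
    obtain ⟨k, hk⟩ := iha
    obtain ⟨l, hl⟩ := ihb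
    refine ⟨2 * k + 2 * l + 2, fun L s h => ?_⟩
    have := hk L s h
    have := hl L s h
    have := ratSize_le_of_height_mul (ratHeight_mul_le (a.eval s) (b.eval s))
    simp only [eval, cost]
    constructor <;> nlinarith

theorem Test.exists_bound (b : Test) :
    ∃ k, ∀ L s, State.Bounded L s → b.cost s ≤ k * (L + 1) := by
  cases b with
  | natLt a b | natEq a b | ratLt a b =>
    obtain ⟨k, hk⟩ := a.exists_bound
    obtain ⟨l, hl⟩ := b.exists_bound
    refine ⟨2 * k + 2 * l + 1, fun L s h => ?_⟩
    have := hk L s h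
    have := hl L s h
    simp only [cost]
    nlinarith

/-- The program has no loop. -/
def Program.LoopFree : Program → Prop
  | .seq P Q | .ite _ P Q => P.LoopFree ∧ Q.LoopFree
  | .while _ _ => False
  | _ => True

/-- The final state of a program without loops. -/
def Program.exec : Program → State → State
  | .skip, s => s
  | .setReg x e, s => { s with reg := Function.update s.reg x (e.eval s) }
  | .setRatReg x e, s => { s with ratReg := Function.update s.ratReg x (e.eval s) }
  | .store a e, s => { s with mem := Function.update s.mem (a.eval s) (e.eval s) }
  | .storeRat a e, s => { s with ratMem := Function.update s.ratMem (a.eval s) (e.eval s) }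
  | .seq P Q, s => Q.exec (P.exec s)
  | .ite b P Q, s => if b.eval s then P.exec s else Q.exec s
  | .while _ _, s => s

theorem forall_update_le {α : Type*} {L L' v : ℕ} {F : ℕ → α} {size : α → ℕ} (x : ℕ) {a : α}
    (h : ∀ y, size (F y) ≤ L) (ha : size a ≤ v) (hv : v ≤ L') (hL : L ≤ L') (y : ℕ) :
    size (Function.update F x a y) ≤ L' := by
  by_cases hy : y = x
  · subst hy; simpa using ha.trans hv
  · simpa [hy] using (h y).trans hL

theorem Program.exists_runs (P : Program) (hP : P.LoopFree) :
    ∃ k, ∀ L s, State.Bounded L s →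
      (P.exec s).Bounded (k * (L + 1)) ∧ ∃ t, Runs P s t (P.exec s) ∧ t ≤ k * (L + 1) := by
  induction P with
  | skip =>
    exact ⟨1, fun L s h => ⟨h.mono (by omega), 1, .skip s, by omega⟩⟩
  | setReg x e =>
    obtain ⟨k, hk⟩ := e.exists_bound
    refine ⟨2 * k + 1, fun L s h => ?_⟩
    have := hk L s h
    have hL : L ≤ (2 * k + 1) * (L + 1) := by nlinarith
    have h' := h.mono hL
    exact ⟨⟨forall_update_le x h.reg this.1 (by nlinarith) hL, h'.ratReg, h'.mem, h'.ratMem⟩,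
      _, .setReg x e s, by nlinarith⟩
  | setRatReg x e =>
    obtain ⟨k, hk⟩ := e.exists_bound
    refine ⟨2 * k + 1, fun L s h => ?_⟩
    have := hk L s h
    have hL : L ≤ (2 * k + 1) * (L + 1) := by nlinarith
    have h' := h.mono hL
    exact ⟨⟨h'.reg, forall_update_le x h.ratReg this.1 (by nlinarith) hL, h'.mem, h'.ratMem⟩,
      _, .setRatReg x e s, by nlinarith⟩
  | store a e =>
    obtain ⟨l, hl⟩ := a.exists_bound
    obtain ⟨k, hk⟩ := e.exists_bound
    refine ⟨2 * l + 2 * k + 1, fun L s h => ?_⟩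
    have := hl L s h
    have := hk L s h
    have hL : L ≤ (2 * l + 2 * k + 1) * (L + 1) := by nlinarith
    have h' := h.mono hL
    exact ⟨⟨h'.reg, h'.ratReg, forall_update_le _ h.mem this.1 (by nlinarith) hL, h'.ratMem⟩,
      _, .store a e s, by nlinarith⟩
  | storeRat a e =>
    obtain ⟨l, hl⟩ := a.exists_bound
    obtain ⟨k, hk⟩ := e.exists_bound
    refine ⟨2 * l + 2 * k + 1, fun L s h => ?_⟩
    have := hl L s h
    have := hk L s h
    have hL : L ≤ (2 * l + 2 * k + 1) * (L + 1) := by nlinarith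
    have h' := h.mono hL
    exact ⟨⟨h'.reg, h'.ratReg, h'.mem, forall_update_le _ h.ratMem this.1 (by nlinarith) hL⟩,
      _, .storeRat a e s, by nlinarith⟩
  | seq P Q ihP ihQ =>
    obtain ⟨k, hk⟩ := ihP hP.1
    obtain ⟨l, hl⟩ := ihQ hP.2
    -- `Q` starts with numbers of up to `k * (L + 1)` bits, so its bound is `l * (k * (L + 1) + 1)`.
    refine ⟨k + l * (k + 1), fun L s h => ?_⟩
    obtain ⟨h1, t1, r1, ht1⟩ := hk L s h
    obtain ⟨h2, t2, r2, ht2⟩ := hl _ _ h1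
    have : l * (k * (L + 1) + 1) ≤ l * (k + 1) * (L + 1) := by
      rw [mul_assoc]; exact Nat.mul_le_mul_left _ (by nlinarith)
    exact ⟨h2.mono (by nlinarith), _, .seq r1 r2, by nlinarith⟩
  | ite b P Q ihP ihQ =>
    obtain ⟨j, hj⟩ := b.exists_bound
    obtain ⟨k, hk⟩ := ihP hP.1
    obtain ⟨l, hl⟩ := ihQ hP.2
    refine ⟨j + k + l, fun L s h => ?_⟩
    have := hj L s h
    obtain ⟨h1, t1, r1, ht1⟩ := hk L s h
    obtain ⟨h2, t2, r2, ht2⟩ := hl L s h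
    by_cases hb : b.eval s = true
    · simp only [exec, hb, if_true]
      exact ⟨h1.mono (by nlinarith), _, .ite_true hb r1, by nlinarith⟩
    · simp only [exec, hb]
      exact ⟨h2.mono (by nlinarith), _, .ite_false (by simpa using hb) r2, by nlinarith⟩
  | _ => exact hP.elim

/-- A loop whose body has no loop makes at most `T` rounds with an invariant `Inv 0, …, Inv T`. -/
theorem Program.exists_runs_while (b : Test) (P : Program) (hP : P.LoopFree) :
    ∃ k, ∀ (L T : ℕ) (Inv : ℕ → State → Prop),
      (∀ i, i < T → ∀ s, Inv i s → s.Bounded L ∧ b.eval s = true ∧ Inv (i + 1) (P.exec s)) →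
      (∀ s, Inv T s → s.Bounded L ∧ b.eval s = false) →
      ∀ s, Inv 0 s → ∃ t s', Runs (.while b P) s t s' ∧ t ≤ (T + 1) * (k * (L + 1)) ∧ Inv T s' := by
  obtain ⟨j, hj⟩ := b.exists_bound
  obtain ⟨k, hk⟩ := P.exists_runs hP
  refine ⟨j + k, fun L T Inv hstep hend s hs => ?_⟩
  have key : ∀ r i, i + r = T → ∀ s, Inv i s →
      ∃ t s', Runs (.while b P) s t s' ∧ t ≤ (r + 1) * ((j + k) * (L + 1)) ∧ Inv T s' := by
    intro r
    induction r with
    | zero =>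
      intro i hi s hs
      obtain rfl : i = T := by omega
      obtain ⟨hb, he⟩ := hend s hs
      have := hj L s hb
      exact ⟨_, s, .while_false he, by nlinarith, hs⟩
    | succ r ih =>
      intro i hi s hs
      obtain ⟨hb, he, hnext⟩ := hstep i (by omega) s hs
      have := hj L s hb
      -- The size bound on the state after the body is dropped, since iterating it would grow
      -- exponentially; the invariant supplies the uniform bound for the next round.
      obtain ⟨-, t, hr, ht⟩ := hk L s hb
      obtain ⟨t', s', hr', ht', hT⟩ := ih (i + 1) (by omega) _ hnext
      exact ⟨_, s', .while_true he hr hr', by nlinarith, hT⟩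
  exact key T 0 (by omega) s hs

/-! ## Digits -/

/-- The digit of `y` with weight `B ^ k`. -/
def digit (B k y : ℕ) : ℕ := y / B ^ k % B

theorem pow_le_of_digit_pos {B k y : ℕ} (h : 0 < digit B k y) : B ^ k ≤ y := by
  by_contra hlt
  simp [digit, Nat.div_eq_of_lt (not_le.1 hlt)] at h

/-- A positive digit is lowered without a borrow. Hence subtracting `B ^ k` also leaves the other
digits alone, as the next lemma states. -/
theorem digit_sub_self {B k y : ℕ} (hB : 0 < B) (h : 0 < digit B k y) :
    digit B k (y - B ^ k) = digit B k y - 1 := by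
  have hk : 0 < B ^ k := pow_pos hB k
  unfold digit at *
  have h1 : (y - B ^ k) / B ^ k = y / B ^ k - 1 := by
    simpa using Nat.sub_mul_div y (B ^ k) 1
  rw [h1]
  set z := y / B ^ k
  have hz : z = z % B - 1 + 1 + B * (z / B) := by have := Nat.mod_add_div z B; omega
  conv_lhs => rw [hz]
  rw [show z % B - 1 + 1 + B * (z / B) - 1 = z % B - 1 + B * (z / B) by omega,
    Nat.add_mul_mod_self_left]
  exact Nat.mod_eq_of_lt (by have := Nat.mod_lt z hB; omega)

theorem digit_sub_of_ne {B k l y : ℕ} (hB : 0 < B) (h : 0 < digit B k y) (hl : l ≠ k) :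
    digit B l (y - B ^ k) = digit B l y := by
  rcases lt_or_gt_of_ne hl with hlt | hlt
  · obtain ⟨d, rfl⟩ := Nat.exists_eq_add_of_lt hlt
    have hle := pow_le_of_digit_pos h
    unfold digit
    rw [show B ^ (l + d + 1) = B ^ l * (B * B ^ d) by ring] at hle ⊢
    rw [Nat.sub_mul_div]
    have h2 : B * B ^ d ≤ y / B ^ l := by
      rw [Nat.le_div_iff_mul_le (pow_pos hB l)]; linarith
    obtain ⟨z, hz⟩ := Nat.exists_eq_add_of_le h2
    rw [hz, Nat.add_sub_cancel_left, Nat.mul_add_mod]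
  · obtain ⟨d, rfl⟩ := Nat.exists_eq_add_of_lt hlt
    unfold digit at *
    have h1 : (y - B ^ k) / B ^ k = y / B ^ k - 1 := by
      simpa using Nat.sub_mul_div y (B ^ k) 1
    rw [show B ^ (k + d + 1) = B ^ k * (B * B ^ d) by ring, ← Nat.div_div_eq_div_mul,
      ← Nat.div_div_eq_div_mul, ← Nat.div_div_eq_div_mul, ← Nat.div_div_eq_div_mul, h1]
    set z := y / B ^ k
    congr 2
    have hz : z - 1 = z % B - 1 + B * (z / B) := by have := Nat.mod_add_div z B; omega
    rw [hz, Nat.add_mul_div_left _ _ hB,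
      Nat.div_eq_of_lt (by have := Nat.mod_lt z hB; omega), zero_add]

theorem exists_digits {B N : ℕ} (d : Fin N → Fin B) :
    ∃ y < B ^ N, ∀ k : Fin N, digit B k y = d k := by
  refine ⟨finFunctionFinEquiv d, (finFunctionFinEquiv d).2, fun k => ?_⟩
  have := finFunctionFinEquiv_symm_apply_val (finFunctionFinEquiv d) k
  rw [Equiv.symm_apply_apply] at this
  exact this.symm

theorem card_filter_range {m : ℕ} (P : ℕ → Prop) [DecidablePred P] :
    ((range m).filter P).card = (univ.filter fun j : Fin m => P j).card := by
  rw [card_filter, card_filter, Fin.sum_univ_eq_sum_range fun l => if P l then 1 else 0]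

namespace Problem

variable (I : Problem)

/-! ## Dynamic programming over the numbers of items in `c` slots

A number `y < base ^ (2 * c)` names a partial assignment up to equivalence: its lower `c` digits
are the winners of `c` slots, and its upper `c` digits the numbers of items in the slots. -/

/-- Larger than every bidder index and every possible number of items, so each fits into one digit.
-/
def base : ℕ := I.n + I.m + 1

theorem base_pos : 0 < I.base := Nat.succ_pos _

/-- The winner of slot `i`. -/
def winner (i y : ℕ) : ℕ := digit I.base i y % I.n

theorem winner_lt (i y : ℕ) : I.winner i y < I.n := Nat.mod_lt _ I.n_pos

/-- The number of items in slot `i`. -/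
def count (c i y : ℕ) : ℕ := digit I.base (c + i) y

/-- The number of items that are assigned. -/
def total (c y : ℕ) : ℕ := ∑ i ∈ range c, I.count c i y

/-- It vanishes when all items are assigned and every nonempty slot has at least `K` of them. -/
def defect (c y : ℕ) : ℕ :=
  ∑ i ∈ range c, I.count c i y * (I.K - I.count c i y) +
    ((I.m - I.total c y) + (I.total c y - I.m))

/-- The welfare gained by assigning item `j` to bidder `w`. -/
def gain (w j : ℕ) : ℚ := I.input.ratMem (I.m + (w * I.m + j)) * I.input.ratMem j

/-- The table entry for `y` that results from adding the last item to slot `i`. -/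
def candidate (c : ℕ) (F : ℕ → ℚ) (i y : ℕ) : ℚ :=
  -- Some indices have a total above `m`; the reduction modulo `m` keeps their reads inside the
  -- input.
  F (y - I.base ^ (c + i)) + I.gain (I.winner i y) ((I.total c y - 1) % I.m)

/-- The decrement of `y` and the winner for an item in slot `i`, in one number. -/
def code (c i y : ℕ) : ℕ := I.base ^ (c + i) * I.base + I.winner i y

/-- The tables `F` of values and `G` of codes are correct at `y`. -/
structure IsTable (c : ℕ) (F : ℕ → ℚ) (G : ℕ → ℕ) (y : ℕ) : Prop where
  le : ∀ i < c, 0 < I.count c i y → I.candidate c F i y ≤ F y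
  eq : 0 < I.total c y →
    ∃ i < c, 0 < I.count c i y ∧ F y = I.candidate c F i y ∧ G y = I.code c i y
  zero : I.total c y = 0 → F y = 0

variable {I} {c : ℕ}

theorem winner_lt_base (i y : ℕ) : I.winner i y < I.base := by
  have := I.winner_lt i y
  unfold base
  omega

/-- Leaves the code 0 free to mean that no slot has been chosen. -/
theorem code_pos (i y : ℕ) : 0 < I.code c i y :=
  Nat.add_pos_left (Nat.mul_pos (pow_pos I.base_pos _) I.base_pos) _

theorem code_div (i y : ℕ) : I.code c i y / I.base = I.base ^ (c + i) := by
  rw [code, mul_comm, Nat.mul_add_div I.base_pos, Nat.div_eq_of_lt (winner_lt_base i y), add_zero]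

theorem code_mod (i y : ℕ) : I.code c i y % I.base = I.winner i y := by
  rw [code, mul_comm, Nat.mul_add_mod, Nat.mod_eq_of_lt (winner_lt_base i y)]

/-! ### Removing one item from a slot -/

theorem count_sub_self {i y : ℕ} (h : 0 < I.count c i y) :
    I.count c i (y - I.base ^ (c + i)) + 1 = I.count c i y := by
  unfold count at *
  rw [digit_sub_self I.base_pos h]
  omega

theorem count_sub_of_ne {i l y : ℕ} (h : 0 < I.count c i y) (hl : l ≠ i) :
    I.count c l (y - I.base ^ (c + i)) = I.count c l y :=
  digit_sub_of_ne I.base_pos h (by omega)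

theorem winner_sub {i l y : ℕ} (h : 0 < I.count c i y) (hl : l < c) :
    I.winner l (y - I.base ^ (c + i)) = I.winner l y := by
  rw [winner, winner, digit_sub_of_ne I.base_pos h (by omega)]

theorem total_sub {i y : ℕ} (hi : i < c) (h : 0 < I.count c i y) :
    I.total c (y - I.base ^ (c + i)) + 1 = I.total c y := by
  have hi' : i ∈ range c := mem_range.2 hi
  unfold total
  rw [← sum_erase_add _ _ hi', ← sum_erase_add (range c) (fun l => I.count c l y) hi', add_assoc,
    count_sub_self h]
  congr 1
  exact sum_congr rfl fun l hl => count_sub_of_ne h (mem_erase.1 hl).1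

theorem sub_lt_of_count_pos {i y : ℕ} (h : 0 < I.count c i y) :
    y - I.base ^ (c + i) < y := by
  have := pow_le_of_digit_pos h
  have := pow_pos I.base_pos (c + i)
  omega

/-- Correctness at `y` involves values at indices up to `y` only, so it survives later writes. -/
theorem IsTable.congr {F F' : ℕ → ℚ} {G G' : ℕ → ℕ} {y : ℕ} (h : I.IsTable c F G y)
    (hF : ∀ z ≤ y, F' z = F z) (hG : G' y = G y) : I.IsTable c F' G' y := by
  have hc : ∀ i, I.candidate c F' i y = I.candidate c F i y := fun i => by
    rw [candidate, candidate, hF _ (Nat.sub_le _ _)]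
  refine ⟨fun i hi h0 => ?_, fun h0 => ?_, fun h0 => ?_⟩
  · rw [hc, hF y le_rfl]; exact h.le i hi h0
  · obtain ⟨i, hi, h1, h2, h3⟩ := h.eq h0
    exact ⟨i, hi, h1, by rw [hc, hF y le_rfl, h2], by rw [hG, h3]⟩
  · rw [hF y le_rfl]; exact h.zero h0

/-- The table bounds the welfare of every partial assignment. -/
theorem sum_gain_le {F : ℕ → ℚ} {G : ℕ → ℕ} {Y : ℕ} (hT : ∀ y < Y, I.IsTable c F G y)
    (s : ℕ → ℕ) {t : ℕ} (ht : t ≤ I.m) (hs : ∀ j < t, s j < c) {y : ℕ} (hy : y < Y)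
    (hcount : ∀ i < c, ((range t).filter fun j => s j = i).card = I.count c i y) :
    ∑ j ∈ range t, I.gain (I.winner (s j) y) j ≤ F y := by
  induction t generalizing y with
  | zero =>
    have : I.total c y = 0 := sum_eq_zero fun i hi => by
      rw [← hcount i (mem_range.1 hi)]; simp
    simp [(hT y hy).zero this]
  | succ t ih =>
    have hi := hs t (Nat.lt_succ_self t)
    have hstep : ∀ i, ((range (t + 1)).filter fun j => s j = i).card =
        ((range t).filter fun j => s j = i).card + if s t = i then 1 else 0 := fun i => by
      rw [card_filter, sum_range_succ, ← card_filter]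
    have hpos : 0 < I.count c (s t) y := by
      rw [← hcount _ hi, hstep]; simp
    have htot : I.total c y = t + 1 := by
      rw [total, ← sum_congr rfl fun i hi => hcount i (mem_range.1 hi),
        ← card_eq_sum_card_fiberwise (f := s) (t := range c)]
      · simp
      · intro j hj; simpa using hs j (by simpa using hj)
    have hle := (hT y hy).le _ hi hpos
    -- Taking item `t` out of its slot gives a smaller index whose slots keep their winners.
    have hprev := ih (by omega) (fun j hj => hs j (by omega))
      ((sub_lt_of_count_pos hpos).trans hy) fun i hic => by
        by_cases h : i = s t
        · subst h
          have := hcount _ hic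
          rw [hstep] at this
          have h2 := count_sub_self hpos
          simp at this
          omega
        · rw [count_sub_of_ne hpos h, ← hcount i hic, hstep]
          simp [Ne.symm h]
    have hsum : ∑ j ∈ range t, I.gain (I.winner (s j) y) j =
        ∑ j ∈ range t, I.gain (I.winner (s j) (y - I.base ^ (c + s t))) j :=
      sum_congr rfl fun j hj => by
        rw [winner_sub hpos (hs j (by have := mem_range.1 hj; omega))]
    rw [candidate, htot, Nat.add_sub_cancel, Nat.mod_eq_of_lt (by omega)] at hle
    rw [sum_range_succ, hsum]
    exact (add_le_add_left hprev _).trans hle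

/-! ### Gains read from the input, and complete assignments as indices -/

theorem input_ratMem_p (j : Fin I.m) : I.input.ratMem j = I.p j := by
  simp [input]

theorem input_ratMem_v (i : Fin I.n) (j : Fin I.m) :
    I.input.ratMem (I.m + (i * I.m + j)) = I.v i j := by
  have h1 : (i * I.m + j : ℕ) / I.m = i := by
    rw [mul_comm, Nat.mul_add_div I.items_pos, Nat.div_eq_of_lt j.2, add_zero]
  have h2 : (i * I.m + j : ℕ) % I.m = j := by
    rw [mul_comm, Nat.mul_add_mod, Nat.mod_eq_of_lt j.2]
  simp [input, h1, h2]

theorem gain_eq (i : Fin I.n) (j : Fin I.m) : I.gain i j = I.V i j := by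
  rw [gain, input_ratMem_p, input_ratMem_v, V]

theorem value_eq_sum_gain {a : Fin I.m → Fin I.n} {w : ℕ → ℕ} (ha : ∀ j : Fin I.m, w j = a j) :
    I.value a = ∑ j ∈ range I.m, I.gain (w j) j := by
  rw [value, ← Fin.sum_univ_eq_sum_range fun j => I.gain (w j) j]
  exact sum_congr rfl fun j _ => by rw [ha, gain_eq]

theorem defect_eq_zero {y : ℕ} : I.defect c y = 0 ↔
    I.total c y = I.m ∧ ∀ i < c, I.count c i y = 0 ∨ I.K ≤ I.count c i y := by
  have h : ∑ i ∈ range c, I.count c i y * (I.K - I.count c i y) = 0 ↔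
      ∀ i < c, I.count c i y = 0 ∨ I.K ≤ I.count c i y := by
    simp [sum_eq_zero_iff, Nat.sub_eq_zero_iff_le]
  rw [← h, defect]
  omega

/-- Several slots may share a winner. This is harmless: it only reduces the number of signals, and
the support of a signal contains that of each of its slots, where a nonempty slot already has `K`
items. -/
theorem isAdmissible_of_slots {y : ℕ} (hy : I.defect c y = 0) (s : ℕ → ℕ)
    (hs : ∀ j < I.m, s j < c)
    (hcount : ∀ i < c, ((range I.m).filter fun j => s j = i).card = I.count c i y)
    {a : Fin I.m → Fin I.n} (ha : ∀ j : Fin I.m, I.winner (s j) y = a j) :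
    I.IsAdmissible c (I.schemeOf a) := by
  rw [isAdmissible_schemeOf]
  constructor
  · have h : (univ.image a).map Fin.valEmbedding ⊆ (range c).image fun i => I.winner i y := by
      intro x hx
      simp only [mem_map, mem_image, mem_univ, true_and] at hx
      obtain ⟨_, ⟨j, rfl⟩, rfl⟩ := hx
      exact mem_image.2 ⟨s j, mem_range.2 (hs j j.2), ha j⟩
    rw [← card_map Fin.valEmbedding]
    exact (card_le_card h).trans (card_image_le.trans (card_range c).le)
  · intro j
    have hj := hcount _ (hs j j.2)
    rw [card_filter_range fun l => s l = s j] at hj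
    have hpos : 0 < (univ.filter fun l : Fin I.m => s l = s j).card :=
      card_pos.2 ⟨j, by simp⟩
    have hK : I.K ≤ (univ.filter fun l : Fin I.m => s l = s j).card := by
      rcases (defect_eq_zero.1 hy).2 _ (hs j j.2) with h | h <;> omega
    refine hK.trans (card_le_card fun l hl => ?_)
    have hl' : s l = s j := (mem_filter.1 hl).2
    simp only [mem_filter, mem_univ, true_and]
    exact Fin.val_injective (by rw [← ha, ← ha, hl'])

/-- One slot per bidder used by `b`. Together with `sum_gain_le` this shows that no admissible
assignment is missed by the table. -/
theorem exists_slots {b : Fin I.m → Fin I.n} (hb : I.IsAdmissible c (I.schemeOf b)) :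
    ∃ y < I.base ^ (2 * c), I.defect c y = 0 ∧ ∃ s : ℕ → ℕ, (∀ j < I.m, s j < c) ∧
      (∀ i < c, ((range I.m).filter fun j => s j = i).card = I.count c i y) ∧
      ∀ j : Fin I.m, I.winner (s j) y = b j := by
  rw [isAdmissible_schemeOf] at hb
  obtain ⟨hcard, hK⟩ := hb
  let e := (univ.image b).equivFin
  let slot : Fin I.m → ℕ := fun j => e ⟨b j, mem_image_of_mem b (mem_univ j)⟩
  have hslot : ∀ j l, slot l = slot j ↔ b l = b j := fun j l => by
    simp [slot, Fin.val_inj]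
  let s : ℕ → ℕ := fun j => if h : j < I.m then slot ⟨j, h⟩ else 0
  have hs : ∀ j : Fin I.m, s j = slot j := fun j => by simp [s]
  -- Surplus slots get winner 0 and remain empty.
  let w : ℕ → ℕ := fun k => if h : k < (univ.image b).card then (e.symm ⟨k, h⟩ : Fin I.n) else 0
  have hw : ∀ k, w k < I.n := fun k => by
    simp only [w]
    split_ifs
    · exact Fin.is_lt _
    · exact I.n_pos
  have hws : ∀ j : Fin I.m, w (s j) = b j := fun j => by
    rw [hs]; simp [w, slot]
  let cnt : ℕ → ℕ := fun i => ((range I.m).filter fun j => s j = i).card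
  have hcnt : ∀ i, cnt i < I.base := fun i => by
    have : cnt i ≤ I.m := (card_filter_le _ _).trans (card_range _).le
    unfold base
    omega
  obtain ⟨y, hy, hd⟩ := exists_digits (B := I.base) (N := 2 * c) fun k =>
    if (k : ℕ) < c then ⟨w k, by have := hw k; unfold base; omega⟩ else ⟨cnt (k - c), hcnt _⟩
  have hcount : ∀ i < c, cnt i = I.count c i y := fun i hi => by
    have := hd ⟨c + i, by omega⟩
    simp only [add_lt_iff_neg_left, not_lt_zero, if_false, Nat.add_sub_cancel_left] at this
    exact this.symm
  have hsc : ∀ j < I.m, s j < c := fun j hj => by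
    rw [hs ⟨j, hj⟩]
    exact (Fin.is_lt _).trans_le hcard
  refine ⟨y, hy, defect_eq_zero.2 ⟨?_, fun i hi => ?_⟩, s, hsc, hcount, fun j => ?_⟩
  · rw [total, ← sum_congr rfl fun i hi => hcount i (mem_range.1 hi),
      ← card_eq_sum_card_fiberwise (f := s) (t := range c)]
    · simp
    · intro j hj; simpa using hsc j (by simpa using hj)
  · rw [← hcount i hi]
    by_cases h : ∃ j : Fin I.m, s j = i
    · right
      obtain ⟨j, rfl⟩ := h
      simp only [cnt]
      rw [card_filter_range fun l => s l = s j]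
      simp only [hs, hslot]
      exact hK j
    · left
      simp only [cnt]
      rw [card_filter_range fun l => s l = i, card_eq_zero, filter_eq_empty_iff]
      exact fun j _ hj => h ⟨j, hj⟩
  · have hsj := hsc j j.2
    have := hd ⟨s j, by omega⟩
    simp only [hsj, if_true] at this
    rw [winner, this, Nat.mod_eq_of_lt (hw _), hws]

end Problem

/-! ## The program

Registers: `n`, `m`, `K` (0 to 2), the table index (3), the item during the output (4), the code of
the best slot (5), whether a complete assignment was found (6), and the index of the best one (7).
Rational registers: the best value for the index (0) and the best value of a complete assignment
(1). The values are kept in the rational memory behind the input, the codes in the memory behind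
the output. -/

theorem Test.natLt_eval (a b : NatExp) (s : State) :
    (Test.natLt a b).eval s = true ↔ a.eval s < b.eval s := by simp [Test.eval]

theorem Test.natEq_eval (a b : NatExp) (s : State) :
    (Test.natEq a b).eval s = true ↔ a.eval s = b.eval s := by simp [Test.eval]

theorem Test.ratLt_eval (a b : RatExp) (s : State) :
    (Test.ratLt a b).eval s = true ↔ a.eval s < b.eval s := by simp [Test.eval]

namespace Code

def baseE : NatExp := .add (.add (.reg 0) (.reg 1)) (.const 1)

def powE : ℕ → NatExp
  | 0 => .const 1
  | k + 1 => .mul (powE k) baseE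

def sumE (F : ℕ → NatExp) : ℕ → NatExp
  | 0 => .const 0
  | k + 1 => .add (sumE F k) (F k)

def digitE (k : ℕ) : NatExp := .mod (.div (.reg 3) (powE k)) baseE

def winnerE (i : ℕ) : NatExp := .mod (digitE i) (.reg 0)

def countE (c i : ℕ) : NatExp := digitE (c + i)

def totalE (c : ℕ) : NatExp := sumE (countE c) c

def defectE (c : ℕ) : NatExp :=
  .add (sumE (fun i => .mul (countE c i) (.sub (.reg 2) (countE c i))) c)
    (.add (.sub (.reg 1) (totalE c)) (.sub (totalE c) (.reg 1)))

def tableE (e : NatExp) : NatExp := .add (.add (.reg 1) (.mul (.reg 0) (.reg 1))) e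

def itemE (c : ℕ) : NatExp := .mod (.sub (totalE c) (.const 1)) (.reg 1)

def candidateE (c i : ℕ) : RatExp :=
  .add (.load (tableE (.sub (.reg 3) (powE (c + i)))))
    (.mul (.load (.add (.reg 1) (.add (.mul (winnerE i) (.reg 1)) (itemE c)))) (.load (itemE c)))

def codeE (c i : ℕ) : NatExp := .add (.mul (powE (c + i)) baseE) (winnerE i)

def take (c i : ℕ) : Program := .seq (.setReg 5 (codeE c i)) (.setRatReg 0 (candidateE c i))

/-- Values may be negative, so the initial 0 is no substitute for minus infinity: the first nonempty
slot is taken without comparison, as recognized by code 0. Register 6 plays the same role in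
`update`. -/
def relaxSlot (c i : ℕ) : Program :=
  .ite (.natLt (.const 0) (countE c i))
    (.ite (.natEq (.reg 5) (.const 0)) (take c i)
      (.ite (.ratLt (.reg 0) (candidateE c i)) (take c i) .skip))
    .skip

def relax (c : ℕ) : ℕ → Program
  | 0 => .skip
  | k + 1 => .seq (relax c k) (relaxSlot c k)

def keep : Program :=
  .seq (.setReg 6 (.const 1)) (.seq (.setReg 7 (.reg 3)) (.setRatReg 1 (.reg 0)))

def update (c : ℕ) : Program :=
  .ite (.natEq (defectE c) (.const 0))
    (.ite (.natEq (.reg 6) (.const 0)) keep (.ite (.ratLt (.reg 1) (.reg 0)) keep .skip))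
    .skip

def fill (c : ℕ) : Program :=
  .seq (.setReg 5 (.const 0)) (.seq (.setRatReg 0 (.const 0)) (.seq (relax c c)
    (.seq (.storeRat (tableE (.reg 3)) (.reg 0)) (.seq (.store (.add (.reg 1) (.reg 3)) (.reg 5))
      (.seq (update c) (.setReg 3 (.add (.reg 3) (.const 1))))))))

/-- Undoes the last placement: the stored code gives the winner of that item modulo `base`, and the
decrement of the index on division by `base`. -/
def trace : Program :=
  .seq (.store (.sub (.reg 4) (.const 1)) (.mod (.load (.add (.reg 1) (.reg 7))) baseE))
    (.seq (.setReg 7 (.sub (.reg 7) (.div (.load (.add (.reg 1) (.reg 7))) baseE)))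
      (.setReg 4 (.sub (.reg 4) (.const 1))))

def fillTest (c : ℕ) : Test := .natLt (.reg 3) (powE (2 * c))

def traceTest : Test := .natLt (.const 0) (.reg 4)

/-- The program for schemes with at most `c` signals. -/
def main (c : ℕ) : Program :=
  .seq (.while (fillTest c) (fill c)) (.seq (.setReg 4 (.mul (.reg 1) (.reg 6)))
    (.seq (.while traceTest trace) (.setReg 0 (.reg 6))))

theorem relax_loopFree (c k : ℕ) : (relax c k).LoopFree := by
  induction k with
  | zero => trivial
  | succ k ih => exact ⟨ih, ⟨⟨trivial, trivial⟩, ⟨trivial, trivial⟩, trivial⟩, trivial⟩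

theorem fill_loopFree (c : ℕ) : (fill c).LoopFree :=
  ⟨trivial, trivial, relax_loopFree c c, trivial, trivial,
    ⟨⟨⟨trivial, trivial, trivial⟩, ⟨trivial, trivial, trivial⟩, trivial⟩, trivial⟩, trivial⟩

theorem trace_loopFree : trace.LoopFree := ⟨trivial, trivial, trivial⟩

end Code

open Code

/-! ### Semantics of the expressions and of the relaxation -/

namespace Problem

/-- The state holds the table index `y`, and the numbers of the input in their registers. -/
structure AtIndex (I : Problem) (y : ℕ) (s : State) : Prop where
  bidders : s.reg 0 = I.n
  items : s.reg 1 = I.m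
  minimum : s.reg 2 = I.K
  index : s.reg 3 = y

variable {I : Problem} {c y : ℕ} {s : State}

namespace AtIndex

theorem baseE_eval (h : I.AtIndex y s) : baseE.eval s = I.base := by
  simp [baseE, NatExp.eval, h.bidders, h.items, base]

theorem powE_eval (h : I.AtIndex y s) (k : ℕ) : (powE k).eval s = I.base ^ k := by
  induction k with
  | zero => rfl
  | succ k ih => simp [powE, NatExp.eval, ih, h.baseE_eval, pow_succ]

theorem digitE_eval (h : I.AtIndex y s) (k : ℕ) : (digitE k).eval s = digit I.base k y := by
  simp [digitE, NatExp.eval, h.baseE_eval, h.powE_eval, h.index, digit]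

theorem winnerE_eval (h : I.AtIndex y s) (i : ℕ) : (winnerE i).eval s = I.winner i y := by
  simp [winnerE, NatExp.eval, h.digitE_eval, h.bidders, winner]

theorem countE_eval (h : I.AtIndex y s) (i : ℕ) : (countE c i).eval s = I.count c i y :=
  h.digitE_eval _

theorem _root_.KAnon.Code.sumE_eval (F : ℕ → NatExp) (k : ℕ) (s : State) :
    (sumE F k).eval s = ∑ i ∈ range k, (F i).eval s := by
  induction k with
  | zero => rfl
  | succ k ih => rw [sumE, NatExp.eval, ih, sum_range_succ]

theorem totalE_eval (h : I.AtIndex y s) : (totalE c).eval s = I.total c y := by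
  simp [totalE, sumE_eval, h.countE_eval, total]

theorem defectE_eval (h : I.AtIndex y s) : (defectE c).eval s = I.defect c y := by
  simp [defectE, sumE_eval, NatExp.eval, h.countE_eval, h.totalE_eval, h.items, h.minimum, defect]

theorem itemE_eval (h : I.AtIndex y s) : (itemE c).eval s = (I.total c y - 1) % I.m := by
  simp [itemE, NatExp.eval, h.totalE_eval, h.items]

theorem tableE_eval (h : I.AtIndex y s) (e : NatExp) :
    (tableE e).eval s = I.m + I.n * I.m + e.eval s := by
  simp [tableE, NatExp.eval, h.items, h.bidders]

theorem codeE_eval (h : I.AtIndex y s) (i : ℕ) : (codeE c i).eval s = I.code c i y := by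
  simp [codeE, NatExp.eval, h.powE_eval, h.baseE_eval, h.winnerE_eval, code]

end AtIndex

variable (I) in
/-- The table of values that the state holds. -/
def values (s : State) (z : ℕ) : ℚ := s.ratMem (I.m + I.n * I.m + z)

variable (I) in
/-- The table of codes that the state holds. -/
def codes (s : State) (z : ℕ) : ℕ := s.mem (I.m + z)

variable (I) in
/-- The rational memory still holds the input. -/
def HoldsInput (s : State) : Prop :=
  ∀ x < I.m + I.n * I.m, s.ratMem x = I.input.ratMem x

theorem candidateE_eval (h : I.AtIndex y s) (hs : I.HoldsInput s) (i : ℕ) :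
    (candidateE c i).eval s = I.candidate c (I.values s) i y := by
  have hj : (I.total c y - 1) % I.m < I.m := Nat.mod_lt _ I.items_pos
  have hw := I.winner_lt i y
  have hlt : I.winner i y * I.m + (I.total c y - 1) % I.m < I.n * I.m := by nlinarith
  simp only [candidateE, RatExp.eval, h.tableE_eval, NatExp.eval, h.index, h.powE_eval, h.items,
    h.winnerE_eval, h.itemE_eval, candidate, values, gain]
  rw [hs (I.m + _) (by omega), hs (_ % _) (by omega)]

/-- The effect of a round of relaxations: register 5 and rational register 0 hold the best slot. -/
theorem exec_relax (h : I.AtIndex y s) (hs : I.HoldsInput s) (h5 : s.reg 5 = 0) (k : ℕ) :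
    ∃ g v, (relax c k).exec s = { s with
        reg := Function.update s.reg 5 g, ratReg := Function.update s.ratReg 0 v } ∧
      (g = 0 → v = s.ratReg 0 ∧ ∀ i < k, I.count c i y = 0) ∧
      (g ≠ 0 → ∃ i < k, 0 < I.count c i y ∧ v = I.candidate c (I.values s) i y ∧
        g = I.code c i y) ∧
      ∀ i < k, 0 < I.count c i y → I.candidate c (I.values s) i y ≤ v := by
  induction k with
  | zero =>
    refine ⟨0, s.ratReg 0, ?_, by simp, by simp, by simp⟩
    have : Function.update s.reg 5 0 = s.reg := by rw [← h5, Function.update_eq_self]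
    simp [relax, Program.exec, this]
  | succ k ih =>
    obtain ⟨g, v, he, h0, h1, h2⟩ := ih
    set s' : State := { s with
        reg := Function.update s.reg 5 g, ratReg := Function.update s.ratReg 0 v } with hs'
    have hat : I.AtIndex y s' := ⟨by simp [hs', h.bidders], by simp [hs', h.items],
      by simp [hs', h.minimum], by simp [hs', h.index]⟩
    -- `take` writes register 5 before it evaluates the candidate, hence in a modified state.
    have hat' : ∀ x, I.AtIndex y { s' with reg := Function.update s'.reg 5 x } := fun x =>
      ⟨by simp [hs', h.bidders], by simp [hs', h.items], by simp [hs', h.minimum],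
        by simp [hs', h.index]⟩
    have hin : I.HoldsInput s' := hs
    have hcand : (candidateE c k).eval s' = I.candidate c (I.values s) k y :=
      candidateE_eval hat hin k
    have htake : (take c k).exec s' = { s with
        reg := Function.update s.reg 5 (I.code c k y),
        ratReg := Function.update s.ratReg 0 (I.candidate c (I.values s) k y) } := by
      have hcand' : (candidateE c k).eval
          { s' with reg := Function.update s'.reg 5 (I.code c k y) } =
            I.candidate c (I.values s) k y := candidateE_eval (hat' _) hin k
      simp only [take, Program.exec, hat.codeE_eval, hcand']
      simp [hs']
    have hexec : (relax c (k + 1)).exec s = (relaxSlot c k).exec s' := by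
      rw [relax, Program.exec, he]
    rw [hexec]
    have hg : s'.reg 5 = g := by simp [hs']
    have hv : s'.ratReg 0 = v := by simp [hs']
    simp only [relaxSlot, Program.exec, Test.natLt_eval, Test.natEq_eval, Test.ratLt_eval,
      NatExp.eval, RatExp.eval, hat.countE_eval, hcand, hg, hv]
    have took : 0 < I.count c k y → (∀ i < k, 0 < I.count c i y →
        I.candidate c (I.values s) i y ≤ I.candidate c (I.values s) k y) →
        ∃ g v, (take c k).exec s' = { s with
          reg := Function.update s.reg 5 g, ratReg := Function.update s.ratReg 0 v } ∧
        (g = 0 → v = s.ratReg 0 ∧ ∀ i < k + 1, I.count c i y = 0) ∧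
        (g ≠ 0 → ∃ i < k + 1, 0 < I.count c i y ∧ v = I.candidate c (I.values s) i y ∧
          g = I.code c i y) ∧
        ∀ i < k + 1, 0 < I.count c i y → I.candidate c (I.values s) i y ≤ v := by
      intro hpos hle
      refine ⟨_, _, htake, fun h => absurd h (code_pos k y).ne', fun _ =>
        ⟨k, Nat.lt_succ_self k, hpos, rfl, rfl⟩, fun i hi hi' => ?_⟩
      rcases Nat.lt_succ_iff_lt_or_eq.1 hi with h | rfl
      · exact hle i h hi'
      · exact le_rfl
    split_ifs with hpos hg0 hlt
    · exact took hpos fun i hi hi' => absurd ((h0 hg0).2 i hi) hi'.ne'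
    · exact took hpos fun i hi hi' => (h2 i hi hi').trans hlt.le
    · refine ⟨g, v, rfl, fun h => absurd h hg0, fun h => ?_, fun i hi hi' => ?_⟩
      · obtain ⟨i, hi, h⟩ := h1 h
        exact ⟨i, by omega, h⟩
      · rcases Nat.lt_succ_iff_lt_or_eq.1 hi with h | rfl
        · exact h2 i h hi'
        · exact not_lt.1 hlt
    · refine ⟨g, v, rfl, fun h => ⟨(h0 h).1, fun i hi => ?_⟩, fun h => ?_, fun i hi hi' => ?_⟩
      · rcases Nat.lt_succ_iff_lt_or_eq.1 hi with h' | rfl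
        · exact (h0 h).2 i h'
        · omega
      · obtain ⟨i, hi, h⟩ := h1 h
        exact ⟨i, by omega, h⟩
      · rcases Nat.lt_succ_iff_lt_or_eq.1 hi with h' | rfl
        · exact h2 i h' hi'
        · exact absurd hi' hpos

/-! ## The table is filled correctly -/

variable (I c) in
/-- A bound for the natural numbers that occur, up to the number of bits of `K`. -/
def natBound : ℕ := (I.size + 1) ^ (2 * c) + I.size + 1

variable (I c) in
/-- The invariant of the first loop. -/
structure Filled (y : ℕ) (s : State) : Prop where
  at_index : I.AtIndex y s
  index_le : y ≤ I.base ^ (2 * c)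
  reg_size : ∀ x, (s.reg x).size ≤ I.natBound c
  mem_size : ∀ x, (s.mem x).size ≤ I.natBound c
  ratReg_height : ∀ x, ratHeight (s.ratReg x) ≤ 2 ^ (2 * I.size * (y + 1))
  ratMem_height : ∀ x, ratHeight (s.ratMem x) ≤ 2 ^ (2 * I.size * (y + 1))
  holds_input : I.HoldsInput s
  is_table : ∀ z < y, I.IsTable c (I.values s) (I.codes s) z
  not_found : s.reg 6 = 0 → ∀ z < y, I.defect c z ≠ 0
  found : s.reg 6 ≠ 0 → s.reg 6 = 1 ∧ s.reg 7 < y ∧ I.defect c (s.reg 7) = 0 ∧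
    s.ratReg 1 = I.values s (s.reg 7) ∧
    ∀ z < y, I.defect c z = 0 → I.values s z ≤ I.values s (s.reg 7)

/-! ### Sizes of the numbers that occur -/

theorem base_le : I.base ≤ I.size + 1 := by unfold base size; omega

/-- Bounding bits by the value itself suffices here, as these values are polynomial in the input
size; only `K` has to be measured by its bits. -/
theorem size_le_natBound {a : ℕ} (ha : a ≤ I.base ^ (2 * c) + I.base) : a.size ≤ I.natBound c := by
  have h1 := size_le_self a
  have h2 := Nat.pow_le_pow_left (base_le (I := I)) (2 * c)
  have h3 := base_le (I := I)
  unfold natBound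
  omega

theorem code_size {i : ℕ} (hi : i < c) : (I.code c i y).size ≤ I.natBound c := by
  refine size_le_natBound (Nat.add_le_add ?_ (winner_lt_base i y).le)
  rw [← pow_succ]
  exact Nat.pow_le_pow_right I.base_pos (by omega)

theorem ratSize_p_le (j : Fin I.m) : ratSize (I.p j) ≤ I.size := by
  have := single_le_sum (f := fun j => ratSize (I.p j)) (fun _ _ => Nat.zero_le _) (mem_univ j)
  unfold size
  omega

theorem ratSize_v_le (i : Fin I.n) (j : Fin I.m) : ratSize (I.v i j) ≤ I.size := by
  have h1 := single_le_sum (f := fun j => ratSize (I.v i j)) (fun _ _ => Nat.zero_le _)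
    (mem_univ j)
  have h2 := single_le_sum (f := fun i => ∑ j, ratSize (I.v i j)) (fun _ _ => Nat.zero_le _)
    (mem_univ i)
  unfold size
  omega

theorem input_ratMem_height (x : ℕ) : ratHeight (I.input.ratMem x) ≤ 2 ^ I.size := by
  have h : ∀ q, ratSize q ≤ I.size → ratHeight q ≤ 2 ^ I.size := fun q hq =>
    (ratHeight_le_two_pow q).trans (Nat.pow_le_pow_right two_pos hq)
  simp only [input]
  split_ifs
  · exact h _ (ratSize_p_le _)
  · exact h _ (ratSize_v_le _ _)
  · simpa [ratHeight] using Nat.one_le_two_pow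

theorem gain_height (w j : ℕ) : ratHeight (I.gain w j) ≤ 2 ^ (2 * I.size) := by
  rw [two_mul, pow_add]
  exact (ratHeight_mul_le _ _).trans
    (Nat.mul_le_mul (input_ratMem_height _) (input_ratMem_height _))

/-- A candidate adds one gain, a product of two input numbers, to an earlier entry; this accounts
for one more factor `2 ^ (2 * size)` per round. -/
theorem Filled.candidate_height (h : I.Filled c y s) (i : ℕ) :
    ratHeight (I.candidate c (I.values s) i y) ≤ 2 ^ (2 * I.size * (y + 1 + 1)) := by
  rw [mul_add (2 * I.size) (y + 1), pow_add, mul_one]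
  exact (ratHeight_add_le _ _).trans (Nat.mul_le_mul (h.ratMem_height _) (gain_height _ _))

theorem two_pow_height_mono {a b : ℕ} (h : a ≤ b) :
    2 ^ (2 * I.size * a) ≤ 2 ^ (2 * I.size * b) :=
  Nat.pow_le_pow_right two_pos (Nat.mul_le_mul_left _ h)

theorem filled_input : I.Filled c 0 I.input where
  at_index := ⟨rfl, rfl, rfl, rfl⟩
  index_le := Nat.zero_le _
  reg_size x := by
    have h : 0 < I.base ^ (2 * c) := pow_pos I.base_pos _
    simp only [input]
    split_ifs
    · exact size_le_natBound (by unfold base; omega)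
    · exact size_le_natBound (by unfold base; omega)
    · unfold natBound size; omega
    · simp
  mem_size x := by simp [input]
  ratReg_height x := by simpa [input, ratHeight] using Nat.one_le_two_pow
  ratMem_height x := (input_ratMem_height x).trans
    (Nat.pow_le_pow_right two_pos (by omega))
  holds_input := fun _ _ => rfl
  is_table := by simp
  not_found := by simp
  found := by simp [input]

/-- The state after the first loop has treated the index of `s`, if it computed the code `g` and
the value `v`, but before the index is raised. -/
theorem exec_fill (h : I.AtIndex y s) (hs : I.HoldsInput s) :
    ∃ g v, (fill c).exec s = (Program.exec (.setReg 3 (.add (.reg 3) (.const 1)))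
        ((update c).exec
        { reg := Function.update s.reg 5 g, ratReg := Function.update s.ratReg 0 v,
          mem := Function.update s.mem (I.m + y) g,
          ratMem := Function.update s.ratMem (I.m + I.n * I.m + y) v })) ∧
      (g = 0 → v = 0 ∧ ∀ i < c, I.count c i y = 0) ∧
      (g ≠ 0 → ∃ i < c, 0 < I.count c i y ∧ v = I.candidate c (I.values s) i y ∧
        g = I.code c i y) ∧
      ∀ i < c, 0 < I.count c i y → I.candidate c (I.values s) i y ≤ v := by
  set s' : State := { s with
    reg := Function.update s.reg 5 0, ratReg := Function.update s.ratReg 0 0 } with hs'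
  have hat : I.AtIndex y s' := ⟨by simp [hs', h.bidders], by simp [hs', h.items],
    by simp [hs', h.minimum], by simp [hs', h.index]⟩
  obtain ⟨g, v, he, h0, h1, h2⟩ := exec_relax (c := c) hat hs (by simp [hs']) c
  have hv : I.values s' = I.values s := rfl
  rw [hv] at h1 h2
  refine ⟨g, v, ?_, fun hg => ⟨by simpa [hs'] using (h0 hg).1, (h0 hg).2⟩, h1, h2⟩
  have hstart : (fill c).exec s = Program.exec (.seq
      (.storeRat (tableE (.reg 3)) (.reg 0)) (.seq (.store (.add (.reg 1) (.reg 3)) (.reg 5))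
      (.seq (update c) (.setReg 3 (.add (.reg 3) (.const 1)))))) ((relax c c).exec s') := by
    simp [fill, Program.exec, NatExp.eval, RatExp.eval, hs']
  rw [hstart, he]
  simp [Program.exec, NatExp.eval, RatExp.eval, tableE, hs', h.bidders, h.items, h.index]

/-- A candidate from a nonempty slot reads a strictly smaller index, so writing the entry at `y`
does not change what it was compared with. -/
theorem isTable_of_relax {F F' : ℕ → ℚ} {G : ℕ → ℕ} (hF : ∀ z < y, F' z = F z)
    (h0 : G y = 0 → F' y = 0 ∧ ∀ i < c, I.count c i y = 0)
    (h1 : G y ≠ 0 → ∃ i < c, 0 < I.count c i y ∧ F' y = I.candidate c F i y ∧ G y = I.code c i y)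
    (h2 : ∀ i < c, 0 < I.count c i y → I.candidate c F i y ≤ F' y) : I.IsTable c F' G y := by
  have hc : ∀ i, 0 < I.count c i y → I.candidate c F' i y = I.candidate c F i y := fun i hi => by
    rw [candidate, candidate, hF _ (sub_lt_of_count_pos hi)]
  refine ⟨fun i hi h => by rw [hc i h]; exact h2 i hi h, fun h => ?_, fun h => ?_⟩
  · have hg : G y ≠ 0 := fun hg => h.ne' (sum_eq_zero fun i hi => (h0 hg).2 i (mem_range.1 hi))
    obtain ⟨i, hi, hp, hv, hcode⟩ := h1 hg
    exact ⟨i, hi, hp, by rw [hc i hp, hv], hcode⟩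
  · refine (h0 ?_).1
    by_contra hg
    obtain ⟨i, hi, hp, -⟩ := h1 hg
    exact hp.ne' (sum_eq_zero_iff.1 h i (mem_range.2 hi))

theorem exec_update (h : I.AtIndex y s) : (update c).exec s =
    if I.defect c y = 0 ∧ (s.reg 6 = 0 ∨ s.ratReg 1 < s.ratReg 0) then
      { s with
        reg := Function.update (Function.update s.reg 6 1) 7 y,
        ratReg := Function.update s.ratReg 1 (s.ratReg 0) }
    else s := by
  have hk : keep.exec s = { s with
      reg := Function.update (Function.update s.reg 6 1) 7 y,
      ratReg := Function.update s.ratReg 1 (s.ratReg 0) } := by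
    simp [keep, Program.exec, NatExp.eval, RatExp.eval, h.index]
  simp only [update, Program.exec, Test.natEq_eval, Test.ratLt_eval, NatExp.eval, RatExp.eval,
    h.defectE_eval, hk]
  by_cases h1 : I.defect c y = 0 <;> by_cases h2 : s.reg 6 = 0 <;>
    by_cases h3 : s.ratReg 1 < s.ratReg 0 <;> simp [h1, h2, h3]

theorem Filled.step (h : I.Filled c y s) (hy : y < I.base ^ (2 * c)) :
    I.Filled c (y + 1) ((fill c).exec s) := by
  obtain ⟨g, v, he, h0, h1, h2⟩ := exec_fill (c := c) h.at_index h.holds_input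
  set s' : State :=
    { reg := Function.update s.reg 5 g, ratReg := Function.update s.ratReg 0 v,
      mem := Function.update s.mem (I.m + y) g,
      ratMem := Function.update s.ratMem (I.m + I.n * I.m + y) v } with hs'
  have hat : I.AtIndex y s' := ⟨by simp [hs', h.at_index.bidders],
    by simp [hs', h.at_index.items], by simp [hs', h.at_index.minimum],
    by simp [hs', h.at_index.index]⟩
  have hgsize : g.size ≤ I.natBound c := by
    by_cases hg : g = 0
    · simp [hg]
    · obtain ⟨i, hi, -, -, rfl⟩ := h1 hg
      exact code_size hi
  have hvheight : ratHeight v ≤ 2 ^ (2 * I.size * (y + 1 + 1)) := by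
    by_cases hg : g = 0
    · simpa [(h0 hg).1, ratHeight] using Nat.one_le_two_pow
    · obtain ⟨i, -, -, rfl, -⟩ := h1 hg
      exact h.candidate_height i
  have hmono : 2 ^ (2 * I.size * (y + 1)) ≤ 2 ^ (2 * I.size * (y + 1 + 1)) :=
    two_pow_height_mono (Nat.le_succ _)
  have hreg : ∀ x, (s'.reg x).size ≤ I.natBound c :=
    forall_update_le 5 h.reg_size hgsize le_rfl le_rfl
  have hmem : ∀ x, (s'.mem x).size ≤ I.natBound c :=
    forall_update_le _ h.mem_size hgsize le_rfl le_rfl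
  have hratReg : ∀ x, ratHeight (s'.ratReg x) ≤ 2 ^ (2 * I.size * (y + 1 + 1)) :=
    forall_update_le 0 h.ratReg_height hvheight le_rfl hmono
  have hratMem : ∀ x, ratHeight (s'.ratMem x) ≤ 2 ^ (2 * I.size * (y + 1 + 1)) :=
    forall_update_le _ h.ratMem_height hvheight le_rfl hmono
  have hin : I.HoldsInput s' := fun x hx => by
    rw [← h.holds_input x hx]
    exact Function.update_of_ne (by omega) _ _
  have hvalues : ∀ z < y, I.values s' z = I.values s z := fun z hz =>
    Function.update_of_ne (by omega) _ _
  have hcodes : ∀ z < y, I.codes s' z = I.codes s z := fun z hz =>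
    Function.update_of_ne (by omega) _ _
  have hvy : I.values s' y = v := Function.update_self _ _ _
  have hgy : I.codes s' y = g := Function.update_self _ _ _
  have htable : ∀ z < y + 1, I.IsTable c (I.values s') (I.codes s') z := by
    intro z hz
    rcases Nat.lt_succ_iff_lt_or_eq.1 hz with hz | rfl
    · exact (h.is_table z hz).congr (fun x hx => hvalues x (by omega)) (hcodes z hz)
    · exact isTable_of_relax hvalues (by rwa [hvy, hgy]) (by rwa [hvy, hgy]) (by rwa [hvy])
  have hysize : (y + 1).size ≤ I.natBound c := size_le_natBound (by omega)
  have h6 : s'.reg 6 = s.reg 6 := by simp [hs']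
  have h7 : s'.reg 7 = s.reg 7 := by simp [hs']
  have hq0 : s'.ratReg 0 = v := by simp [hs']
  have hq1 : s'.ratReg 1 = s.ratReg 1 := by simp [hs']
  have hindex : s'.reg 3 = y := hat.index
  rw [he, exec_update hat]
  split_ifs with hc
  · have hone : Nat.size 1 ≤ I.natBound c := size_le_natBound (by unfold base; omega)
    -- Either no complete assignment was known before, or the new value strictly exceeds the
    -- recorded best.
    have hbest : ∀ z < y, I.defect c z = 0 → I.values s z ≤ v := by
      intro z hz hdz
      rw [h6, hq0, hq1] at hc
      rcases hc.2 with hc6 | hlt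
      · exact absurd hdz (h.not_found hc6 z hz)
      · by_cases hc6 : s.reg 6 = 0
        · exact absurd hdz (h.not_found hc6 z hz)
        · obtain ⟨-, -, -, hv, hle⟩ := h.found hc6
          rw [hv] at hlt
          exact (hle z hz hdz).trans hlt.le
    simp only [Program.exec, NatExp.eval]
    refine ⟨⟨?_, ?_, ?_, ?_⟩, hy, ?_, hmem, ?_, hratMem, hin, htable, ?_, ?_⟩
    · simp [hat.bidders]
    · simp [hat.items]
    · simp [hat.minimum]
    · simp [hindex]
    · refine forall_update_le _ (forall_update_le _ (forall_update_le _ hreg hone le_rfl le_rfl)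
        (size_le_natBound (by omega)) le_rfl le_rfl) ?_ le_rfl le_rfl
      simpa [hindex] using hysize
    · exact forall_update_le _ hratReg (hratReg 0) le_rfl le_rfl
    · simp
    · intro _
      refine ⟨by simp, by simp, by simpa using hc.1, ?_, ?_⟩
      · simp only [Function.update_self, ne_eq, Nat.reduceEqDiff, not_false_eq_true,
          Function.update_of_ne, hq0]
        exact hvy.symm
      · intro z hz hdz
        simp only [Function.update_self, ne_eq, Nat.reduceEqDiff, not_false_eq_true,
          Function.update_of_ne]
        change I.values s' z ≤ I.values s' y
        rw [hvy]
        rcases Nat.lt_succ_iff_lt_or_eq.1 hz with hz | rfl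
        · rw [hvalues z hz]; exact hbest z hz hdz
        · exact hvy.le
  · simp only [Program.exec, NatExp.eval]
    refine ⟨⟨?_, ?_, ?_, ?_⟩, hy, ?_, hmem, hratReg, hratMem, hin, htable, ?_, ?_⟩
    · simp [hat.bidders]
    · simp [hat.items]
    · simp [hat.minimum]
    · simp [hindex]
    · refine forall_update_le _ hreg ?_ le_rfl le_rfl
      simpa [hindex] using hysize
    · intro h6' z hz hdz
      replace h6' : s.reg 6 = 0 := by simpa [h6] using h6'
      rcases Nat.lt_succ_iff_lt_or_eq.1 hz with hz | rfl
      · exact h.not_found h6' z hz hdz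
      · exact hc ⟨hdz, Or.inl (h6.trans h6')⟩
    · intro h6'
      replace h6' : s.reg 6 ≠ 0 := by simpa [h6] using h6'
      obtain ⟨f1, f2, f3, f4, f5⟩ := h.found h6'
      simp only [ne_eq, Nat.reduceEqDiff, not_false_eq_true, Function.update_of_ne, h6, h7, hq1]
      change _ ∧ _ ∧ _ ∧ _ = I.values s' _ ∧ ∀ z < y + 1, _ → I.values s' z ≤ I.values s' _
      rw [hvalues _ f2]
      refine ⟨f1, by omega, f3, f4, fun z hz hdz => ?_⟩
      rcases Nat.lt_succ_iff_lt_or_eq.1 hz with hz | rfl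
      · rw [hvalues z hz]; exact f5 z hz hdz
      · rw [hvy, ← f4, ← hq1, ← hq0]
        exact not_lt.1 fun hlt => hc ⟨hdz, Or.inr hlt⟩

end Problem

namespace Problem

variable {I : Problem} {c y : ℕ} {s s₁ : State}

/-! ## The output is read off the table -/

variable (I c) in
/-- The invariant of the second loop, which starts with the tables of `s₁` and has written the
winners of the last `k` items. -/
structure Traced (s₁ : State) (k : ℕ) (s : State) : Prop where
  bidders : s.reg 0 = I.n
  items : s.reg 1 = I.m
  is_found : s.reg 6 = 1
  item : s.reg 4 + k = I.m
  reg_size : ∀ x, (s.reg x).size ≤ I.natBound c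
  mem_size : ∀ x, (s.mem x).size ≤ I.natBound c
  ratReg : s.ratReg = s₁.ratReg
  ratMem : s.ratMem = s₁.ratMem
  codes_eq : ∀ z, I.codes s z = I.codes s₁ z
  index_lt : s.reg 7 < I.base ^ (2 * c)
  total_eq : I.total c (s.reg 7) = s.reg 4
  winner_eq : ∀ i < c, I.winner i (s.reg 7) = I.winner i (s₁.reg 7)
  slots : ∃ σ : ℕ → ℕ,
    (∀ l ∈ Ico (s.reg 4) I.m, σ l < c ∧ s.mem l = I.winner (σ l) (s₁.reg 7)) ∧
    ∀ i < c, I.count c i (s.reg 7) + ((Ico (s.reg 4) I.m).filter fun l => σ l = i).card =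
      I.count c i (s₁.reg 7)
  sum_eq : I.values s₁ (s.reg 7) + ∑ l ∈ Ico (s.reg 4) I.m, I.gain (s.mem l) l =
    I.values s₁ (s₁.reg 7)

theorem exec_trace (h0 : s.reg 0 = I.n) (h1 : s.reg 1 = I.m) (h4 : s.reg 4 ≤ I.m)
    (h4' : 0 < s.reg 4) : trace.exec s = { s with
      mem := Function.update s.mem (s.reg 4 - 1) (I.codes s (s.reg 7) % I.base),
      reg := Function.update
        (Function.update s.reg 7 (s.reg 7 - I.codes s (s.reg 7) / I.base)) 4 (s.reg 4 - 1) } := by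
  -- The output cell lies below `m` and the codes start at `m`, so the second load still sees the
  -- old code.
  have hne : I.m + s.reg 7 ≠ s.reg 4 - 1 := by omega
  simp [trace, Program.exec, NatExp.eval, baseE, h0, h1, codes, base,
    Function.update_of_ne hne]

/-- The stored code names a slot attaining the entry. Moving its item from the index to the output
preserves slot counts, and moves exactly its gain from the entry to the sum of written gains. -/
theorem Traced.step (hF : I.Filled c (I.base ^ (2 * c)) s₁) {k : ℕ} (hk : k < I.m)
    (h : I.Traced c s₁ k s) : I.Traced c s₁ (k + 1) (trace.exec s) := by
  have h4 := h.item
  obtain ⟨j, hj⟩ : ∃ j, s.reg 4 = j + 1 := ⟨s.reg 4 - 1, by omega⟩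
  obtain ⟨i, hi, hpos, hv, hcode⟩ := (hF.is_table _ h.index_lt).eq (by rw [h.total_eq]; omega)
  have hexec := exec_trace (I := I) h.bidders h.items (by omega) (by omega)
  rw [h.codes_eq, hcode, code_mod, code_div, hj, Nat.add_sub_cancel] at hexec
  have htot := total_sub hi hpos
  rw [h.total_eq, hj] at htot
  obtain ⟨σ, hσ, hcount⟩ := h.slots
  have hsum := h.sum_eq
  rw [hv, candidate, h.total_eq, hj, Nat.add_sub_cancel, Nat.mod_eq_of_lt (by omega)] at hsum
  rw [hj] at hσ hcount
  have hlt := sub_lt_of_count_pos hpos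
  rw [hexec]
  have hIco : j < I.m := by omega
  refine ⟨by simp [h.bidders], by simp [h.items], by simp [h.is_found], ?_, ?_, ?_, h.ratReg,
    h.ratMem, fun z => ?_, ?_, ?_, fun l hl => ?_, ?_, ?_⟩
  · simp; omega
  · exact forall_update_le _ (forall_update_le _ h.reg_size
      (Nat.size_le_size hlt.le) (h.reg_size 7) le_rfl)
      (Nat.size_le_size (hj ▸ Nat.le_succ j)) (h.reg_size 4) le_rfl
  · refine forall_update_le _ h.mem_size (size_le_natBound ?_) le_rfl le_rfl
    have := winner_lt_base (I := I) i (s.reg 7)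
    omega
  · rw [← h.codes_eq]
    exact Function.update_of_ne (by omega) _ _
  · simpa using hlt.trans h.index_lt
  · simp; omega
  · simp [winner_sub hpos hl, h.winner_eq l hl]
  · refine ⟨Function.update σ j i, fun l hl => ?_, fun l hl => ?_⟩
    · simp only [Function.update_self] at hl ⊢
      rw [mem_Ico] at hl
      by_cases hlj : l = j
      · subst hlj; simp [hi, h.winner_eq i hi]
      · simpa [hlj] using hσ l (mem_Ico.2 (by omega))
    · have hrest : ((Ico (j + 1) I.m).filter fun x => Function.update σ j i x = l).card =
          ((Ico (j + 1) I.m).filter fun x => σ x = l).card := by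
        congr 1
        refine filter_congr fun x hx => ?_
        rw [Function.update_of_ne (by have := mem_Ico.1 hx; omega)]
      have := hcount l hl
      simp only [Function.update_self, ne_eq, Nat.reduceEqDiff, not_false_eq_true,
        Function.update_of_ne]
      rw [card_filter, sum_eq_sum_Ico_succ_bot hIco, ← card_filter, hrest, Function.update_self]
      by_cases hli : l = i
      · subst hli
        have := count_sub_self hpos
        simp; omega
      · rw [count_sub_of_ne hpos hli]
        simp [Ne.symm hli]; omega
  · have hrest : ∑ l ∈ Ico (j + 1) I.m,
        I.gain (Function.update s.mem j (I.winner i (s.reg 7)) l) l =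
        ∑ l ∈ Ico (j + 1) I.m, I.gain (s.mem l) l :=
      sum_congr rfl fun x hx => by
        rw [Function.update_of_ne (by have := mem_Ico.1 hx; omega)]
    simp only [Function.update_self, ne_eq, Nat.reduceEqDiff, not_false_eq_true,
      Function.update_of_ne]
    rw [sum_eq_sum_Ico_succ_bot hIco, hrest, Function.update_self, ← add_assoc]
    exact hsum

/-- Register 6 is 1 here, so `m * 1` items are traced; when it is 0 the same product makes the
second loop empty. -/
theorem Traced.start (hF : I.Filled c (I.base ^ (2 * c)) s₁) (h6 : s₁.reg 6 ≠ 0) :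
    I.Traced c s₁ 0 (Program.exec (.setReg 4 (.mul (.reg 1) (.reg 6))) s₁) := by
  obtain ⟨f1, f2, f3, -, -⟩ := hF.found h6
  have ht := (defect_eq_zero.1 f3).1
  have hm := hF.at_index.items
  have hmsize := hF.reg_size 1
  simp only [Program.exec, NatExp.eval, f1, hm, mul_one]
  refine ⟨by simp [hF.at_index.bidders], by simp [hm], by simp [f1], by simp, ?_, hF.mem_size,
    rfl, rfl, fun _ => rfl, by simpa using f2, by simpa using ht, fun _ _ => by simp,
    ⟨fun _ => 0, by simp, by simp⟩, by simp⟩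
  exact forall_update_le _ hF.reg_size (hm ▸ hmsize) le_rfl le_rfl

/-- At the end the remaining index holds no items and its entry is 0, so the output attains the best
complete entry, which bounds the value of every admissible assignment. -/
theorem Traced.isAlgorithmResult (hF : I.Filled c (I.base ^ (2 * c)) s₁) (h6 : s₁.reg 6 ≠ 0)
    (h : I.Traced c s₁ I.m s) : ∃ a, I.IsAlgorithmResult c a ∧ I.output s = I.schemeOf a := by
  obtain ⟨-, f2, f3, -, f5⟩ := hF.found h6
  have h4 : s.reg 4 = 0 := by have := h.item; omega
  have ht : I.total c (s.reg 7) = 0 := h.total_eq.trans h4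
  obtain ⟨σ, hσ, hcount⟩ := h.slots
  have hsum := h.sum_eq
  rw [(hF.is_table _ h.index_lt).zero ht, zero_add] at hsum
  rw [h4, ← range_eq_Ico] at hσ hcount hsum
  have ha : ∀ j : Fin I.m, s.mem j = I.winner (σ j) (s₁.reg 7) := fun j =>
    (hσ j (mem_range.2 j.2)).2
  let a : Fin I.m → Fin I.n := fun j => ⟨I.winner (σ j) (s₁.reg 7), I.winner_lt _ _⟩
  refine ⟨a, isAlgorithmResult_iff.2 ⟨?_, fun b hb => ?_⟩, funext ha⟩
  · refine isAdmissible_of_slots f3 σ (fun j hj => (hσ j (mem_range.2 hj)).1) (fun i hi => ?_)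
      fun j => rfl
    have := hcount i hi
    rw [sum_eq_zero_iff.1 ht i (mem_range.2 hi), zero_add] at this
    exact this
  · obtain ⟨y, hy, hd, t, ht, htc, htb⟩ := exists_slots hb
    rw [value_eq_sum_gain (a := a) (w := s.mem) ha, hsum,
      value_eq_sum_gain (w := fun j => I.winner (t j) y) htb]
    exact (sum_gain_le hF.is_table t le_rfl ht hy htc).trans (f5 y hy hd)

theorem Filled.not_admissible (hF : I.Filled c (I.base ^ (2 * c)) s₁) (h6 : s₁.reg 6 = 0) :
    ¬ ∃ φ, I.IsAdmissible c φ := by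
  rintro ⟨φ, hφ⟩
  obtain ⟨b, hb, -⟩ := exists_assignment hφ
  obtain ⟨y, hy, hd, -⟩ := exists_slots hb
  exact hF.not_found h6 y hy hd

/-! ## Running time -/

/-- A bound for the number of bits of the numbers that occur, for an input of size `N`. -/
def bitBound (c N : ℕ) : ℕ :=
  ((N + 1) ^ (2 * c) + N + 1) + (4 * N * ((N + 1) ^ (2 * c) + 1) + 2)

theorem base_pow_le : I.base ^ (2 * c) ≤ (I.size + 1) ^ (2 * c) :=
  Nat.pow_le_pow_left base_le _

theorem natBound_le : I.natBound c ≤ bitBound c I.size := Nat.le_add_right _ _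

theorem ratSize_le_bitBound {q : ℚ} (hy : y ≤ I.base ^ (2 * c))
    (h : ratHeight q ≤ 2 ^ (2 * I.size * (y + 1))) : ratSize q ≤ bitBound c I.size := by
  have h1 := ratSize_le_of_height h
  have h2 := hy.trans base_pow_le
  have h3 : 2 * (2 * I.size * (y + 1)) ≤ 4 * I.size * ((I.size + 1) ^ (2 * c) + 1) := by
    nlinarith
  unfold bitBound
  omega

theorem Filled.bounded (h : I.Filled c y s) : s.Bounded (bitBound c I.size) :=
  ⟨fun x => (h.reg_size x).trans natBound_le, fun x => ratSize_le_bitBound h.index_le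
    (h.ratReg_height x), fun x => (h.mem_size x).trans natBound_le,
    fun x => ratSize_le_bitBound h.index_le (h.ratMem_height x)⟩

theorem Traced.bounded (hF : I.Filled c (I.base ^ (2 * c)) s₁) {k : ℕ}
    (h : I.Traced c s₁ k s) : s.Bounded (bitBound c I.size) :=
  ⟨fun x => (h.reg_size x).trans natBound_le, h.ratReg ▸ hF.bounded.ratReg,
    fun x => (h.mem_size x).trans natBound_le, h.ratMem ▸ hF.bounded.ratMem⟩

/-- Here `s₁` is the state after the first loop and `s₃` the one after the second. The constants
come from the program alone, so one polynomial serves all instances. -/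
theorem exists_runs_main (c : ℕ) : ∃ q : Polynomial ℕ, ∀ I : Problem, ∃ t s s₁ s₃,
    Runs (main c) I.input t s ∧ t ≤ q.eval I.size ∧ I.Filled c (I.base ^ (2 * c)) s₁ ∧
      (s₁.reg 6 = 0 → s.reg 0 = 0) ∧
      (s₁.reg 6 ≠ 0 → s.reg 0 = 1 ∧ I.Traced c s₁ I.m s₃ ∧ s.mem = s₃.mem) := by
  obtain ⟨k₁, hk₁⟩ := Program.exists_runs_while (fillTest c) (fill c) (fill_loopFree c)
  obtain ⟨k₂, hk₂⟩ := Program.exists_runs (.setReg 4 (.mul (.reg 1) (.reg 6))) trivial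
  obtain ⟨k₃, hk₃⟩ := Program.exists_runs_while traceTest trace trace_loopFree
  obtain ⟨k₄, hk₄⟩ := Program.exists_runs (.setReg 0 (.reg 6)) trivial
  let X : Polynomial ℕ := .X
  let L : Polynomial ℕ := ((X + 1) ^ (2 * c) + X + 1) + (4 * X * ((X + 1) ^ (2 * c) + 1) + 2)
  refine ⟨((X + 1) ^ (2 * c) + 1) * (.C k₁ * (L + 1)) + .C k₂ * (L + 1) +
    (X + 1) * (.C k₃ * (.C (k₂ + 1) * (L + 1) + 1)) +
    .C k₄ * (.C (k₂ + 1) * (L + 1) + 1), fun I => ?_⟩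
  have hL : L.eval I.size = bitBound c I.size := by simp [L, X, bitBound]
  simp only [Polynomial.eval_add, Polynomial.eval_mul, Polynomial.eval_pow, Polynomial.eval_C,
    Polynomial.eval_one, hL, X, Polynomial.eval_X]
  set B := bitBound c I.size
  -- A common bit bound for the second loop, whether it is empty or traces.
  have hB : B ≤ (k₂ + 1) * (B + 1) := by nlinarith
  have hB₂ : k₂ * (B + 1) ≤ (k₂ + 1) * (B + 1) := by nlinarith
  obtain ⟨t₁, s₁, r₁, ht₁, hF⟩ := hk₁ B (I.base ^ (2 * c)) (I.Filled c)
    (fun i hi s hs => ⟨hs.bounded, by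
      rw [fillTest, Test.natLt_eval, hs.at_index.powE_eval, NatExp.eval, hs.at_index.index]
      exact hi, hs.step hi⟩)
    (fun s hs => ⟨hs.bounded, by
      rw [← Bool.not_eq_true, fillTest, Test.natLt_eval, hs.at_index.powE_eval, NatExp.eval,
        hs.at_index.index]
      exact lt_irrefl _⟩) _ filled_input
  obtain ⟨hb₂, t₂, r₂, ht₂⟩ := hk₂ B s₁ hF.bounded
  have hY := base_pow_le (I := I) (c := c)
  have hm : I.m ≤ I.size := by unfold size; omega
  have hT₁ : t₁ ≤ ((I.size + 1) ^ (2 * c) + 1) * (k₁ * (B + 1)) :=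
    ht₁.trans (Nat.mul_le_mul_right _ (by omega))
  by_cases h6 : s₁.reg 6 = 0
  -- With nothing found the loop makes zero rounds, so the invariant only records boundedness and
  -- the zero registers.
  · obtain ⟨t₃, s₃, r₃, ht₃, hb₃, -, h63⟩ := hk₃ ((k₂ + 1) * (B + 1)) 0
      (fun _ s => s.Bounded ((k₂ + 1) * (B + 1)) ∧ s.reg 4 = 0 ∧ s.reg 6 = 0) (by simp)
      (fun s hs => ⟨hs.1, by rw [← Bool.not_eq_true, traceTest, Test.natLt_eval]
                             simp [NatExp.eval, hs.2.1]⟩)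
      (Program.exec (.setReg 4 (.mul (.reg 1) (.reg 6))) s₁)
      ⟨hb₂.mono hB₂, by simp [Program.exec, NatExp.eval, h6], by simp [Program.exec, h6]⟩
    obtain ⟨-, t₄, r₄, ht₄⟩ := hk₄ _ s₃ hb₃
    have hT₃ : t₃ ≤ (I.size + 1) * (k₃ * ((k₂ + 1) * (B + 1) + 1)) :=
      ht₃.trans (Nat.mul_le_mul_right _ (by omega))
    exact ⟨_, _, s₁, s₃, .seq r₁ (.seq r₂ (.seq r₃ r₄)), by omega, hF,
      fun _ => by simp [Program.exec, NatExp.eval, h63], fun h => absurd h6 h⟩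
  · obtain ⟨t₃, s₃, r₃, ht₃, hT⟩ := hk₃ ((k₂ + 1) * (B + 1)) I.m (I.Traced c s₁)
      (fun k hk s hs => ⟨(hs.bounded hF).mono hB, by
        rw [traceTest, Test.natLt_eval]
        simp only [NatExp.eval]
        have := hs.item
        omega, hs.step hF hk⟩)
      (fun s hs => ⟨(hs.bounded hF).mono hB, by
        rw [← Bool.not_eq_true, traceTest, Test.natLt_eval]
        simp only [NatExp.eval]
        have := hs.item
        omega⟩) _ (Traced.start hF h6)
    obtain ⟨-, t₄, r₄, ht₄⟩ := hk₄ _ s₃ ((hT.bounded hF).mono hB)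
    have hT₃ : t₃ ≤ (I.size + 1) * (k₃ * ((k₂ + 1) * (B + 1) + 1)) :=
      ht₃.trans (Nat.mul_le_mul_right _ (by omega))
    exact ⟨_, _, s₁, s₃, .seq r₁ (.seq r₂ (.seq r₃ r₄)), by omega, hF,
      fun h => absurd h h6, fun _ => ⟨by simp [Program.exec, NatExp.eval, hT.is_found], hT, rfl⟩⟩

end Problem

end KAnon

/-! ### Correctness and polynomial cost combined -/

theorem mainTheorem6 (c : ℕ) :
    (∀ I : KAnon.Problem,
      (I.winnerSets c).card ≤ I.n ^ c ∧
      ((∃ a, I.IsAlgorithmResult c a) ↔ ∃ φ, I.IsAdmissible c φ) ∧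
      ∀ a, I.IsAlgorithmResult c a → I.IsOptimal c (I.schemeOf a)) ∧
    ∃ (P : KAnon.Program) (q : Polynomial ℕ), ∀ I : KAnon.Problem,
      ∃ (t : ℕ) (s : KAnon.State), KAnon.Runs P I.input t s ∧ t ≤ q.eval I.size ∧
        ((∃ φ, I.IsAdmissible c φ) →
          s.reg 0 = 1 ∧ I.IsOptimal c (I.output s) ∧
            ∃ a, I.IsAlgorithmResult c a ∧ I.output s = I.schemeOf a) ∧
        ((¬ ∃ φ, I.IsAdmissible c φ) → s.reg 0 = 0) := by
  refine ⟨fun I => ⟨I.card_winnerSets_le c, I.exists_isAlgorithmResult_iff c,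
    fun a ha => ha.isOptimal⟩, KAnon.Code.main c, ?_⟩
  obtain ⟨q, hq⟩ := KAnon.Problem.exists_runs_main c
  refine ⟨q, fun I => ?_⟩
  obtain ⟨t, s, s₁, s₃, hr, ht, hF, h0, h1⟩ := hq I
  refine ⟨t, s, hr, ht, fun h => ?_, fun h => ?_⟩
  · have h6 : s₁.reg 6 ≠ 0 := fun h6 => hF.not_admissible h6 h
    obtain ⟨hs, hT, hmem⟩ := h1 h6
    obtain ⟨a, ha, hout⟩ := hT.isAlgorithmResult hF h6
    have hout' : I.output s = I.schemeOf a := by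
      rw [← hout]
      funext j
      simp [KAnon.Problem.output, hmem]
    exact ⟨hs, hout' ▸ ha.isOptimal, a, ha, hout'⟩
  · by_contra hs
    have h6 : s₁.reg 6 ≠ 0 := fun h6 => hs (h0 h6)
    obtain ⟨-, hT, -⟩ := h1 h6
    obtain ⟨a, ha, -⟩ := hT.isAlgorithmResult hF h6
    exact h ⟨_, ha.isOptimal.1⟩
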